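/- **Setting.** Fix $N$ and write $B_j=\{y\in\mathbb R^N: |y|\le j\}$, $j=1,2,\dots$ A *b-measure* is a map $\mu$ from the ring $\mathcal B$ of bounded Borel subsets of $\mathbb R$ to $\mathbb R$ with $\mu(\emptyset)=0$, $\mu(\{t\})=0$ for all $t\in\mathbb R$, and $\mu(\bigcup_n A_n)=\sum_n\mu(A_n)$ for pairwise disjoint $A_n\in\mathcal B$ with $\bigcup_n A_n\in\mathcal B$; its total variation is $|\mu|(A)=\sup\sum_i|\mu(A_i)|$ over finite partitions of $A$ into sets of $\mathcal B$. Let $\mathcal M_c^+$ be the set of locally finite positive Borel measures on $\mathbb R$ without atoms, and let $\omega_1\le\omega_2\le\cdots$ be continuous non-decreasing functions $[0,\infty)\to[0,\infty)$ with $\omega_j(0)=0$. A *parametric b-measure* is a family $\nu=(\nu_y)_{y\in\mathbb R^N}$ of b-measures such that for each $j\ge1$ there are $m_j,l_j\in\mathcal M_c^+$ (an *$m$-bound* and an *$l$-bound* of $\nu$ on $B_j$) with $$|\nu_y|(A)\le m_j(A),\qquad |\nu_{y_1}-\nu_{y_2}|(A)\le l_j(A)\,\omega_j(|y_1-y_2|)\qquad(A\in\mathcal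 B,\ y,y_1,y_2\in B_j).$$ The vector space of these is denoted $\mathfrak M_p$. For $y(\cdot)$ continuous on $[a,b]$, $\int_a^b d\nu_{y(s)}$ is the limit of the Riemann sums $\sum_i\nu_{y(\tau_i)}([t_i,t_{i+1}])$, $\tau_i\in[t_i,t_{i+1}]$, as the mesh of the partition tends to $0$ (this limit exists). In what follows $I=[q_1,q_2]$ with rational $q_1<q_2$. For $D\subset\mathbb R^N$ countable and dense, $\sigma_D$ is the topology on $\mathfrak M_p$ generated by the seminorms $\nu\mapsto|\nu_y(I)|$, $y\in D$. Let $\Theta=\{\theta_j^I\}$ be a family of continuous non-decreasing functions $[0,\infty)\to[0,\infty)$ with $\theta^I_j(0)=0$ and $\theta^{I_1}_{j_1}\le\theta^{I_2}_{j_2}$ whenever $I_1\subseteq I_2$, $j_1\le j_2$; $\sigma_\Theta$ is the topology generated by the seminorms $\nu\mapsto\sup_{y(\cdot)}\big|\int_I d\nu_{y(s)}\big|$, the supremum being over the continuous $y:I\to B_j$ with $|y(t_1)-y(t_2)|\le\theta_j^I(|t_1-t_2|)$ for all $t_1,t_2\in I$. A set $E\subset\mathfrak M_p$ *has equicontinuous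 $m$-bounds* if one can choose $m$-bounds $m_j^\nu$ of each $\nu\in E$ such that for every $j$ and $\varepsilon>0$ there is $\delta>0$ with $m_j^\nu([s,t])<\varepsilon$ whenever $0\le t-s<\delta$ and $\nu\in E$. It *has bounded $l$-bounds* if one can choose $l$-bounds $l_j^\nu$ of each $\nu\in E$ such that for every $j$ there is $c>0$ with $l_j^\nu([t,t+1])\le c$ for all $t\in\mathbb R$, $\nu\in E$. **Theorem.** Let $\mathcal T$ be one of the topologies $\sigma_D$, $\sigma_\Theta$ on $\mathfrak M_p$. (a) If $E\subset\mathfrak M_p$ has equicontinuous $m$-bounds and bounded $l$-bounds, then the closure of $E$ in $(\mathfrak M_p,\mathcal T)$ is compact. (b) Let $(g_\alpha)_{\alpha\in\Gamma}$ be a family of maps $g_\alpha:\mathbb R^N\times\mathbb R\to\mathbb R^N$, Lebesgue measurable in $t$ for each $y$ and continuous in $y$ for a.e. $t$. Suppose that for all $j\ge 1$ and $\alpha$ there are nonnegative locally integrable $\tilde m_j^\alpha,\tilde l_j^\alpha:\mathbb R\to\mathbb R$ such that, for a.e. $t$, $|g_\alpha(y,t)|\le\tilde m_j^\alpha(t)$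 and $|g_\alpha(y_1,t)-g_\alpha(y_2,t)|\le\tilde l_j^\alpha(t)\,\omega_j(|y_1-y_2|)$ for all $y,y_1,y_2\in B_j$ (for $\omega_j=\mathrm{id}$ this is the usual Lipschitz-type Carathéodory condition), and that for each $j$: for every $\varepsilon>0$ there is $\delta>0$ with $\int_s^{s+h}\tilde m_j^\alpha\,dt<\varepsilon$ for all $\alpha\in\Gamma$, $s\in\mathbb R$, $0\le h<\delta$; and there is $c>0$ with $\int_s^{s+1}\tilde l_j^\alpha\,dt\le c$ for all $\alpha\in\Gamma$, $s\in\mathbb R$. Then the formulas $(\nu^{\alpha,i})_y(A)=\int_A (g_\alpha)_i(y,t)\,dt$, $A\in\mathcal B$, define elements $\nu^{\alpha,i}\in\mathfrak M_p$ for $\alpha\in\Gamma$, $1\le i\le N$, and the closure of $\{(\nu^{\alpha,1},\dots,\nu^{\alpha,N}):\alpha\in\Gamma\}$ in $\mathfrak M_p^{\,N}$, with the product topology of $\mathcal T$, is compact. -/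

import Mathlib

open MeasureTheory Set Filter Topology
open scoped NNReal ENNReal

noncomputable section

/-! ### b-measures -/

/-- The ring of bounded Borel subsets of the real line. -/
def IsBddBorel (A : Set ℝ) : Prop := MeasurableSet A ∧ Bornology.IsBounded A

/-- The vector space of continuous real b-measures: countably additive real set functions on the
ring of bounded Borel sets that vanish on points. As for Mathlib's vector measures, the set
function is given the value `0` off its domain, so that two b-measures are equal if and only if
they agree on bounded Borel sets. -/
def bMeasureSubmodule : Submodule ℝ (Set ℝ → ℝ) where
  carrier := {μ |
    (∀ A, ¬ IsBddBorel A → μ A = 0) ∧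
    μ ∅ = 0 ∧
    (∀ A : ℕ → Set ℝ, (∀ n, IsBddBorel (A n)) → Pairwise (fun m n => Disjoint (A m) (A n)) →
      IsBddBorel (⋃ n, A n) → HasSum (fun n => μ (A n)) (μ (⋃ n, A n))) ∧
    ∀ t : ℝ, μ {t} = 0}
  zero_mem' := ⟨fun _ _ => rfl, rfl, fun _ _ _ _ => hasSum_zero, fun _ => rfl⟩
  add_mem' := by
    rintro μ₁ μ₂ ⟨a₁, b₁, c₁, d₁⟩ ⟨a₂, b₂, c₂, d₂⟩
    refine ⟨fun A hA => ?_, ?_, fun A h1 h2 h3 => ?_, fun t => ?_⟩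
    · simp [a₁ A hA, a₂ A hA]
    · simp [b₁, b₂]
    · exact (c₁ A h1 h2 h3).add (c₂ A h1 h2 h3)
    · simp [d₁ t, d₂ t]
  smul_mem' := by
    rintro c μ ⟨a₁, b₁, c₁, d₁⟩
    refine ⟨fun A hA => ?_, ?_, fun A h1 h2 h3 => ?_, fun t => ?_⟩
    · simp [a₁ A hA]
    · simp [b₁]
    · exact (c₁ A h1 h2 h3).mul_left c
    · simp [d₁ t]

/-- The type of (continuous real) b-measures. -/
def BMeasure : Type := ↥bMeasureSubmodule

instance : AddCommGroup BMeasure := inferInstanceAs (AddCommGroup ↥bMeasureSubmodule)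
instance : Module ℝ BMeasure := inferInstanceAs (Module ℝ ↥bMeasureSubmodule)
instance : CoeFun BMeasure (fun _ => Set ℝ → ℝ) := ⟨Subtype.val⟩

theorem BMeasure.add_apply (μ₁ μ₂ : BMeasure) (A : Set ℝ) : (μ₁ + μ₂) A = μ₁ A + μ₂ A := rfl

theorem BMeasure.smul_apply (c : ℝ) (μ : BMeasure) (A : Set ℝ) : (c • μ) A = c * μ A := rfl

theorem BMeasure.sub_apply (μ₁ μ₂ : BMeasure) (A : Set ℝ) : (μ₁ - μ₂) A = μ₁ A - μ₂ A := rfl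

theorem BMeasure.zero_apply (A : Set ℝ) : (0 : BMeasure) A = 0 := rfl

/-- The total variation `|μ|(A)`: the supremum of `∑ |μ (P i)|` over the finite partitions of `A`
into bounded Borel sets. -/
def BMeasure.variation (μ : BMeasure) (A : Set ℝ) : ℝ≥0∞ :=
  ⨆ (n : ℕ) (P : Fin n → Set ℝ)
    (_ : (∀ i, IsBddBorel (P i)) ∧ Pairwise (fun i k => Disjoint (P i) (P k)) ∧ ⋃ i, P i = A),
    ∑ i, ENNReal.ofReal |μ (P i)|

theorem BMeasure.le_variation (μ : BMeasure) {A : Set ℝ} (hA : IsBddBorel A) :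
    ENNReal.ofReal |μ A| ≤ μ.variation A := by
  refine le_iSup_of_le 1 (le_iSup_of_le (fun _ => A) (le_iSup_of_le ⟨fun _ => hA, ?_, ?_⟩ ?_))
  · exact Subsingleton.pairwise
  · exact iUnion_const A
  · simp

theorem BMeasure.variation_zero (A : Set ℝ) : (0 : BMeasure).variation A = 0 := by
  simp [BMeasure.variation, BMeasure.zero_apply]

theorem BMeasure.variation_add_le (μ₁ μ₂ : BMeasure) (A : Set ℝ) :
    (μ₁ + μ₂).variation A ≤ μ₁.variation A + μ₂.variation A := by
  refine iSup_le fun n => iSup_le fun P => iSup_le fun hP => ?_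
  calc ∑ i, ENNReal.ofReal |(μ₁ + μ₂) (P i)|
      ≤ ∑ i, (ENNReal.ofReal |μ₁ (P i)| + ENNReal.ofReal |μ₂ (P i)|) := by
        refine Finset.sum_le_sum fun i _ => ?_
        rw [← ENNReal.ofReal_add (abs_nonneg _) (abs_nonneg _)]
        exact ENNReal.ofReal_le_ofReal (abs_add_le _ _)
    _ = ∑ i, ENNReal.ofReal |μ₁ (P i)| + ∑ i, ENNReal.ofReal |μ₂ (P i)| :=
        Finset.sum_add_distrib
    _ ≤ _ := add_le_add
        (le_iSup_of_le n (le_iSup_of_le P (le_iSup (fun _ => ∑ i, ENNReal.ofReal |μ₁ (P i)|) hP)))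
        (le_iSup_of_le n (le_iSup_of_le P (le_iSup (fun _ => ∑ i, ENNReal.ofReal |μ₂ (P i)|) hP)))

theorem BMeasure.variation_smul_le (c : ℝ) (μ : BMeasure) (A : Set ℝ) :
    (c • μ).variation A ≤ ENNReal.ofReal |c| * μ.variation A := by
  refine iSup_le fun n => iSup_le fun P => iSup_le fun hP => ?_
  calc ∑ i, ENNReal.ofReal |(c • μ) (P i)|
      = ENNReal.ofReal |c| * ∑ i, ENNReal.ofReal |μ (P i)| := by
        rw [Finset.mul_sum]
        refine Finset.sum_congr rfl fun i _ => ?_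
        rw [BMeasure.smul_apply, abs_mul, ENNReal.ofReal_mul (abs_nonneg _)]
    _ ≤ _ := by
        gcongr
        exact le_iSup_of_le n (le_iSup_of_le P (le_iSup (fun _ => ∑ i, ENNReal.ofReal |μ (P i)|) hP))

/-! ### Parametric b-measures -/

/-- Positive Borel measures on the real line that are finite on compact sets (hence regular) and
have no purely discontinuous part, i.e. no atoms. -/
def IsContinuousMeasure (m : Measure ℝ) : Prop := IsLocallyFiniteMeasure m ∧ ∀ t : ℝ, m {t} = 0

/-- A non-decreasing family `ω₁ ≤ ω₂ ≤ …` of moduli of continuity. -/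
structure ModulusFamily where
  toFun : ℕ+ → ℝ≥0 → ℝ≥0
  continuous : ∀ j, Continuous (toFun j)
  monotone : ∀ j, Monotone (toFun j)
  zero : ∀ j, toFun j 0 = 0
  le_of_le : ∀ ⦃i j : ℕ+⦄, i ≤ j → ∀ r, toFun i r ≤ toFun j r

instance : CoeFun ModulusFamily (fun _ => ℕ+ → ℝ≥0 → ℝ≥0) := ⟨ModulusFamily.toFun⟩

/-- `m` is an `m`-bound of `ν` on the closed ball of radius `j`. -/
def IsMBound {N : ℕ} (ν : EuclideanSpace ℝ (Fin N) → BMeasure) (j : ℕ+) (m : Measure ℝ) : Prop :=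
  IsContinuousMeasure m ∧
    ∀ A, IsBddBorel A → ∀ y, ‖y‖ ≤ (j : ℝ) → (ν y).variation A ≤ m A

/-- `l` is an `l`-bound of `ν` on the closed ball of radius `j`. -/
def IsLBound {N : ℕ} (ω : ModulusFamily) (ν : EuclideanSpace ℝ (Fin N) → BMeasure) (j : ℕ+)
    (l : Measure ℝ) : Prop :=
  IsContinuousMeasure l ∧
    ∀ A, IsBddBorel A → ∀ y₁ y₂, ‖y₁‖ ≤ (j : ℝ) → ‖y₂‖ ≤ (j : ℝ) →
      (ν y₁ - ν y₂).variation A ≤ l A * (ω j (nndist y₁ y₂) : ℝ≥0∞)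

theorem IsContinuousMeasure.zero : IsContinuousMeasure 0 :=
  ⟨inferInstance, fun _ => rfl⟩

theorem IsContinuousMeasure.add {m₁ m₂ : Measure ℝ} (h₁ : IsContinuousMeasure m₁)
    (h₂ : IsContinuousMeasure m₂) : IsContinuousMeasure (m₁ + m₂) := by
  have := h₁.1; have := h₂.1
  refine ⟨⟨fun x => ?_⟩, fun x => by simp [h₁.2 x, h₂.2 x]⟩
  obtain ⟨s, hs, hs'⟩ := m₁.finiteAt_nhds x
  obtain ⟨t, ht, ht'⟩ := m₂.finiteAt_nhds x
  refine ⟨s ∩ t, inter_mem hs ht, ?_⟩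
  rw [Measure.add_apply]
  exact ENNReal.add_lt_top.2 ⟨(measure_mono inter_subset_left).trans_lt hs',
    (measure_mono inter_subset_right).trans_lt ht'⟩

theorem IsContinuousMeasure.smul {m : Measure ℝ} (h : IsContinuousMeasure m) (c : ℝ≥0) :
    IsContinuousMeasure ((c : ℝ≥0∞) • m) := by
  have := h.1
  refine ⟨⟨fun x => ?_⟩, fun x => by simp [h.2 x]⟩
  obtain ⟨s, hs, hs'⟩ := m.finiteAt_nhds x
  refine ⟨s, hs, ?_⟩
  rw [Measure.smul_apply, smul_eq_mul]
  exact ENNReal.mul_lt_top ENNReal.coe_lt_top hs'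

/-- The vector space of parametric b-measures on `ℝ^N` with respect to the moduli `ω`. -/
def paramBMeasureSubmodule (N : ℕ) (ω : ModulusFamily) :
    Submodule ℝ (EuclideanSpace ℝ (Fin N) → BMeasure) where
  carrier := {ν | ∀ j : ℕ+, ∃ m l : Measure ℝ, IsMBound ν j m ∧ IsLBound ω ν j l}
  zero_mem' := fun j => ⟨0, 0,
    ⟨IsContinuousMeasure.zero, fun A _ y _ => by simp [BMeasure.variation_zero]⟩,
    ⟨IsContinuousMeasure.zero, fun A _ y₁ y₂ _ _ => by simp [BMeasure.variation_zero]⟩⟩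
  add_mem' := by
    intro ν₁ ν₂ h₁ h₂ j
    obtain ⟨m₁, l₁, hm₁, hl₁⟩ := h₁ j
    obtain ⟨m₂, l₂, hm₂, hl₂⟩ := h₂ j
    refine ⟨m₁ + m₂, l₁ + l₂, ⟨hm₁.1.add hm₂.1, fun A hA y hy => ?_⟩,
      ⟨hl₁.1.add hl₂.1, fun A hA y₁ y₂ hy₁ hy₂ => ?_⟩⟩
    · exact (BMeasure.variation_add_le _ _ _).trans
        (add_le_add (hm₁.2 A hA y hy) (hm₂.2 A hA y hy))
    · have e : (ν₁ + ν₂) y₁ - (ν₁ + ν₂) y₂ = (ν₁ y₁ - ν₁ y₂) + (ν₂ y₁ - ν₂ y₂) := by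
        simp only [Pi.add_apply]; abel
      rw [e, Measure.add_apply, add_mul]
      exact (BMeasure.variation_add_le _ _ _).trans
        (add_le_add (hl₁.2 A hA y₁ y₂ hy₁ hy₂) (hl₂.2 A hA y₁ y₂ hy₁ hy₂))
  smul_mem' := by
    intro c ν h j
    obtain ⟨m, l, hm, hl⟩ := h j
    refine ⟨(|c|.toNNReal : ℝ≥0∞) • m, (|c|.toNNReal : ℝ≥0∞) • l,
      ⟨hm.1.smul _, fun A hA y hy => ?_⟩, ⟨hl.1.smul _, fun A hA y₁ y₂ hy₁ hy₂ => ?_⟩⟩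
    · refine (BMeasure.variation_smul_le _ _ _).trans ?_
      rw [Measure.smul_apply, smul_eq_mul]
      exact mul_le_mul_right (hm.2 A hA y hy) _
    · have e : (c • ν) y₁ - (c • ν) y₂ = c • (ν y₁ - ν y₂) := by
        simp only [Pi.smul_apply, smul_sub]
      rw [e, Measure.smul_apply, smul_eq_mul, mul_assoc]
      refine (BMeasure.variation_smul_le _ _ _).trans ?_
      exact mul_le_mul_right (hl.2 A hA y₁ y₂ hy₁ hy₂) _

/-- The type of parametric b-measures on `ℝ^N` with respect to the moduli `ω`. -/
def ParamBMeasure (N : ℕ) (ω : ModulusFamily) : Type := ↥(paramBMeasureSubmodule N ω)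

section
variable {N : ℕ} {ω : ModulusFamily}

instance : AddCommGroup (ParamBMeasure N ω) :=
  inferInstanceAs (AddCommGroup ↥(paramBMeasureSubmodule N ω))
instance : Module ℝ (ParamBMeasure N ω) :=
  inferInstanceAs (Module ℝ ↥(paramBMeasureSubmodule N ω))
instance : CoeFun (ParamBMeasure N ω) (fun _ => EuclideanSpace ℝ (Fin N) → BMeasure) :=
  ⟨Subtype.val⟩

theorem ParamBMeasure.add_apply (ν₁ ν₂ : ParamBMeasure N ω) (y : EuclideanSpace ℝ (Fin N))
    (A : Set ℝ) : (ν₁ + ν₂) y A = ν₁ y A + ν₂ y A := rfl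

theorem ParamBMeasure.smul_apply (c : ℝ) (ν : ParamBMeasure N ω) (y : EuclideanSpace ℝ (Fin N))
    (A : Set ℝ) : (c • ν) y A = c * ν y A := rfl

/-! ### Integration along curves -/

/-- `(τ i, [t i, t (i+1)])`, `i < n`, is a tagged `δ`-partition of `[a, b]`. -/
def IsTaggedPartition (δ a b : ℝ) (n : ℕ) (t τ : ℕ → ℝ) : Prop :=
  t 0 = a ∧ t n = b ∧
    ∀ i < n, t i < t (i + 1) ∧ τ i ∈ Icc (t i) (t (i + 1)) ∧ t (i + 1) - t i < δ

/-- The Riemann sum of `ν` along the curve `y` for a tagged partition. -/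
def riemannSum (ν : ParamBMeasure N ω) (y : ℝ → EuclideanSpace ℝ (Fin N)) (n : ℕ)
    (t τ : ℕ → ℝ) : ℝ :=
  ∑ i ∈ Finset.range n, ν (y (τ i)) (Icc (t i) (t (i + 1)))

/-- `L` is the integral `∫_a^b dν_{y(s)}` of `ν` along the curve `y` (only the values of `y` on
`[a, b]` matter). -/
def HasParamIntegral (ν : ParamBMeasure N ω) (y : ℝ → EuclideanSpace ℝ (Fin N)) (a b L : ℝ) :
    Prop :=
  ∀ ε > 0, ∃ δ > 0, ∀ (n : ℕ) (t τ : ℕ → ℝ), IsTaggedPartition δ a b n t τ →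
    |L - riemannSum ν y n t τ| < ε

open Classical in
/-- The integral `∫_a^b dν_{y(s)}`; it exists whenever `y` is continuous on `[a, b]`, see
`hasParamIntegral_paramIntegral`. -/
def paramIntegral (ν : ParamBMeasure N ω) (y : ℝ → EuclideanSpace ℝ (Fin N)) (a b : ℝ) : ℝ :=
  if h : ∃ L, HasParamIntegral ν y a b L then h.choose else 0

theorem exists_taggedPartition {a b δ : ℝ} (hab : a < b) (hδ : 0 < δ) :
    ∃ (n : ℕ) (t τ : ℕ → ℝ), IsTaggedPartition δ a b n t τ := by
  obtain ⟨n, hn⟩ := exists_nat_gt ((b - a) / δ)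
  have hba : 0 < b - a := sub_pos.2 hab
  have hn0 : (0 : ℝ) < n := (div_pos hba hδ).trans hn
  refine ⟨n, fun i => a + i * ((b - a) / n), fun i => a + i * ((b - a) / n), by simp, ?_, ?_⟩
  · field_simp; ring
  · intro i _
    have h1 : 0 < (b - a) / n := div_pos hba hn0
    have h2 : (b - a) / n < δ := by
      rw [div_lt_iff₀ hδ] at hn; rw [div_lt_iff₀ hn0]; linarith
    push_cast
    refine ⟨by linarith, ⟨le_rfl, by linarith⟩, by linarith⟩

theorem HasParamIntegral.unique {ν : ParamBMeasure N ω} {y : ℝ → EuclideanSpace ℝ (Fin N)}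
    {a b L L' : ℝ} (hab : a < b) (h : HasParamIntegral ν y a b L)
    (h' : HasParamIntegral ν y a b L') : L = L' := by
  by_contra hne
  have hpos : 0 < |L - L'| / 2 := by have := abs_pos.2 (sub_ne_zero.2 hne); linarith
  obtain ⟨δ, hδ, H⟩ := h _ hpos
  obtain ⟨δ', hδ', H'⟩ := h' _ hpos
  obtain ⟨n, t, τ, hP⟩ := exists_taggedPartition hab (lt_min hδ hδ')
  have e1 := H n t τ ⟨hP.1, hP.2.1, fun i hi =>
    ⟨(hP.2.2 i hi).1, (hP.2.2 i hi).2.1, (hP.2.2 i hi).2.2.trans_le (min_le_left _ _)⟩⟩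
  have e2 := H' n t τ ⟨hP.1, hP.2.1, fun i hi =>
    ⟨(hP.2.2 i hi).1, (hP.2.2 i hi).2.1, (hP.2.2 i hi).2.2.trans_le (min_le_right _ _)⟩⟩
  rw [abs_sub_comm] at e2
  have := abs_sub_le L (riemannSum ν y n t τ) L'
  linarith

theorem HasParamIntegral.eq {ν : ParamBMeasure N ω} {y : ℝ → EuclideanSpace ℝ (Fin N)}
    {a b L : ℝ} (hab : a < b) (h : HasParamIntegral ν y a b L) : paramIntegral ν y a b = L := by
  have hex : ∃ L, HasParamIntegral ν y a b L := ⟨L, h⟩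
  rw [paramIntegral, dif_pos hex]
  exact hex.choose_spec.unique hab h

theorem HasParamIntegral.add {ν₁ ν₂ : ParamBMeasure N ω} {y : ℝ → EuclideanSpace ℝ (Fin N)}
    {a b L₁ L₂ : ℝ} (h₁ : HasParamIntegral ν₁ y a b L₁) (h₂ : HasParamIntegral ν₂ y a b L₂) :
    HasParamIntegral (ν₁ + ν₂) y a b (L₁ + L₂) := by
  intro ε hε
  obtain ⟨δ, hδ, H⟩ := h₁ _ (half_pos hε)
  obtain ⟨δ', hδ', H'⟩ := h₂ _ (half_pos hε)
  refine ⟨min δ δ', lt_min hδ hδ', fun n t τ hP => ?_⟩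
  have e1 := H n t τ ⟨hP.1, hP.2.1, fun i hi =>
    ⟨(hP.2.2 i hi).1, (hP.2.2 i hi).2.1, (hP.2.2 i hi).2.2.trans_le (min_le_left _ _)⟩⟩
  have e2 := H' n t τ ⟨hP.1, hP.2.1, fun i hi =>
    ⟨(hP.2.2 i hi).1, (hP.2.2 i hi).2.1, (hP.2.2 i hi).2.2.trans_le (min_le_right _ _)⟩⟩
  have e : riemannSum (ν₁ + ν₂) y n t τ = riemannSum ν₁ y n t τ + riemannSum ν₂ y n t τ := by
    simp only [riemannSum, ParamBMeasure.add_apply, Finset.sum_add_distrib]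
  rw [e, add_sub_add_comm]
  exact (abs_add_le _ _).trans_lt (by linarith)

theorem HasParamIntegral.smul {ν : ParamBMeasure N ω} {y : ℝ → EuclideanSpace ℝ (Fin N)}
    {a b L : ℝ} (c : ℝ) (h : HasParamIntegral ν y a b L) :
    HasParamIntegral (c • ν) y a b (c * L) := by
  intro ε hε
  obtain ⟨δ, hδ, H⟩ := h (ε / (|c| + 1)) (by positivity)
  refine ⟨δ, hδ, fun n t τ hP => ?_⟩
  have e : riemannSum (c • ν) y n t τ = c * riemannSum ν y n t τ := by
    simp only [riemannSum, ParamBMeasure.smul_apply, Finset.mul_sum]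
  have h1 := H n t τ hP
  rw [lt_div_iff₀ (by positivity)] at h1
  rw [e, ← mul_sub, abs_mul]
  nlinarith [abs_nonneg (L - riemannSum ν y n t τ)]

theorem IsBddBorel.subset {A B : Set ℝ} (hB : IsBddBorel B) (hA : MeasurableSet A) (h : A ⊆ B) :
    IsBddBorel A := ⟨hA, hB.2.subset h⟩

theorem isBddBorel_Ioc (a b : ℝ) : IsBddBorel (Ioc a b) :=
  ⟨measurableSet_Ioc, Metric.isBounded_Ioc a b⟩

theorem isBddBorel_Icc (a b : ℝ) : IsBddBorel (Icc a b) :=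
  ⟨measurableSet_Icc, Metric.isBounded_Icc a b⟩

theorem BMeasure.union (μ : BMeasure) {A B : Set ℝ} (hA : IsBddBorel A) (hB : IsBddBorel B)
    (h : Disjoint A B) : μ (A ∪ B) = μ A + μ B := by
  let F : ℕ → Set ℝ := fun n => if n = 0 then A else if n = 1 then B else ∅
  have hU : ⋃ n, F n = A ∪ B := by
    ext x
    simp only [mem_iUnion, mem_union]
    constructor
    · rintro ⟨n, hn⟩
      by_cases h0 : n = 0
      · left; simpa [F, h0] using hn
      · by_cases h1 : n = 1
        · right; simpa [F, h1] using hn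
        · simp [F, h0, h1] at hn
    · rintro (hx | hx)
      · exact ⟨0, by simpa [F] using hx⟩
      · exact ⟨1, by simpa [F] using hx⟩
  have hF : ∀ n, IsBddBorel (F n) := by
    intro n
    by_cases h0 : n = 0
    · simpa [F, h0] using hA
    · by_cases h1 : n = 1
      · simpa [F, h1] using hB
      · simp only [F, h0, h1, if_false]
        exact ⟨MeasurableSet.empty, Bornology.isBounded_empty⟩
  have hd : Pairwise (fun m n => Disjoint (F m) (F n)) := by
    intro m n hmn
    rcases m with _ | _ | m <;> rcases n with _ | _ | n <;> simp_all [F, h.symm]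
  have hs := μ.2.2.2.1 F hF hd (by rw [hU]; exact ⟨hA.1.union hB.1, hA.2.union hB.2⟩)
  rw [hU] at hs
  have hs' : HasSum (fun n => μ (F n)) (∑ n ∈ Finset.range 2, μ (F n)) := by
    refine hasSum_sum_of_ne_finset_zero fun n hn => ?_
    have : F n = ∅ := by
      simp only [Finset.mem_range, not_lt] at hn
      simp only [F]; rw [if_neg (by omega), if_neg (by omega)]
    rw [this]; exact μ.2.2.1
  have := hs.unique hs'
  simpa [Finset.sum_range_succ, F] using this

theorem BMeasure.Icc_eq_Ioc (μ : BMeasure) {a b : ℝ} (h : a ≤ b) : μ (Icc a b) = μ (Ioc a b) := by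
  have e : Icc a b = {a} ∪ Ioc a b := by rw [singleton_union, Ioc_insert_left h]
  rw [e, μ.union ⟨measurableSet_singleton a, Bornology.isBounded_singleton⟩ (isBddBorel_Ioc a b)
    (by simp), show μ {a} = 0 from μ.2.2.2.2 a, zero_add]

theorem measureReal_union_bdd (l : Measure ℝ) [IsLocallyFiniteMeasure l] {A B : Set ℝ}
    (hA : IsBddBorel A) (hB : IsBddBorel B) (h : Disjoint A B) :
    l.real (A ∪ B) = l.real A + l.real B :=
  measureReal_union h hB.1 hA.2.measure_lt_top.ne hB.2.measure_lt_top.ne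

theorem sum_inter_Ioc {f : Set ℝ → ℝ}
    (hf : ∀ A B, IsBddBorel A → IsBddBorel B → Disjoint A B → f (A ∪ B) = f A + f B)
    {J : Set ℝ} (hJ : IsBddBorel J) (t : ℕ → ℝ) (n : ℕ) (ht : ∀ i < n, t i < t (i + 1)) :
    t 0 ≤ t n ∧ f (J ∩ Ioc (t 0) (t n)) = ∑ i ∈ Finset.range n, f (J ∩ Ioc (t i) (t (i + 1))) := by
  have hb : ∀ a b, IsBddBorel (J ∩ Ioc a b) := fun a b =>
    hJ.subset (hJ.1.inter measurableSet_Ioc) inter_subset_left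
  induction n with
  | zero =>
    have h0 : IsBddBorel (∅ : Set ℝ) := ⟨MeasurableSet.empty, Bornology.isBounded_empty⟩
    have := hf ∅ ∅ h0 h0 (disjoint_empty _)
    simp only [union_self] at this
    refine ⟨le_rfl, ?_⟩
    simp only [Ioc_self, inter_empty, Finset.range_zero, Finset.sum_empty]
    linarith
  | succ n ih =>
    obtain ⟨h1, h2⟩ := ih fun i hi => ht i (by omega)
    have h3 := (ht n (by omega)).le
    refine ⟨h1.trans h3, ?_⟩
    rw [Finset.sum_range_succ, ← h2, ← hf _ _ (hb _ _) (hb _ _), ← inter_union_distrib_left,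
      Ioc_union_Ioc_eq_Ioc h1 h3]
    exact Disjoint.mono inter_subset_right inter_subset_right (Ioc_disjoint_Ioc_of_le le_rfl)

theorem IsTaggedPartition.Icc_subset {δ a b : ℝ} {n : ℕ} {t τ : ℕ → ℝ}
    (h : IsTaggedPartition δ a b n t τ) {i : ℕ} (hi : i < n) : Icc (t i) (t (i + 1)) ⊆ Icc a b := by
  have key : ∀ k ≤ n, ∀ i ≤ k, t i ≤ t k := by
    intro k
    induction k with
    | zero => intro _ i hi; rw [Nat.le_zero.1 hi]
    | succ k ih =>
      intro hk i hi
      rcases Nat.lt_or_ge i (k + 1) with h' | h'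
      · exact (ih (by omega) i (by omega)).trans (h.2.2 k (by omega)).1.le
      · rw [le_antisymm hi h']
  refine Icc_subset_Icc ?_ ?_
  · rw [← h.1]; exact key i hi.le 0 (Nat.zero_le _)
  · rw [← h.2.1]; exact key n le_rfl (i + 1) hi

theorem IsTaggedPartition.mono {δ δ' a b : ℝ} {n : ℕ} {t τ : ℕ → ℝ}
    (h : IsTaggedPartition δ a b n t τ) (hδ : δ ≤ δ') : IsTaggedPartition δ' a b n t τ :=
  ⟨h.1, h.2.1, fun i hi => ⟨(h.2.2 i hi).1, (h.2.2 i hi).2.1, (h.2.2 i hi).2.2.trans_le hδ⟩⟩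

theorem abs_sub_apply_le {ν : EuclideanSpace ℝ (Fin N) → BMeasure} {j : ℕ+} {l : Measure ℝ}
    (hl : IsLBound ω ν j l) {A : Set ℝ} (hA : IsBddBorel A) {y₁ y₂ : EuclideanSpace ℝ (Fin N)}
    (h₁ : ‖y₁‖ ≤ (j : ℝ)) (h₂ : ‖y₂‖ ≤ (j : ℝ)) :
    |ν y₁ A - ν y₂ A| ≤ l.real A * ω j (nndist y₁ y₂) := by
  have := hl.1.1
  have h := ((ν y₁ - ν y₂).le_variation hA).trans (hl.2 A hA y₁ y₂ h₁ h₂)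
  have h' := ENNReal.toReal_mono
    (ENNReal.mul_ne_top hA.2.measure_lt_top.ne ENNReal.coe_ne_top) h
  rwa [ENNReal.toReal_ofReal (abs_nonneg _), ENNReal.toReal_mul, ENNReal.coe_toReal] at h'

theorem abs_apply_le {ν : EuclideanSpace ℝ (Fin N) → BMeasure} {j : ℕ+} {m : Measure ℝ}
    (hm : IsMBound ν j m) {A : Set ℝ} (hA : IsBddBorel A) {y : EuclideanSpace ℝ (Fin N)}
    (h : ‖y‖ ≤ (j : ℝ)) : |ν y A| ≤ m.real A := by
  have := hm.1.1
  have h' := ENNReal.toReal_mono hA.2.measure_lt_top.ne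
    (((ν y).le_variation hA).trans (hm.2 A hA y h))
  rwa [ENNReal.toReal_ofReal (abs_nonneg _)] at h'

/-- Two Riemann sums along a curve whose oscillation over distances `< 2 δ` is at most `η`, as
measured by `ω j`, differ by at most `η · l((a, b])`. -/
theorem abs_riemannSum_sub_le (ν : ParamBMeasure N ω) {j : ℕ+} {l : Measure ℝ}
    (hl : IsLBound ω ν j l) {y : ℝ → EuclideanSpace ℝ (Fin N)} {a b δ η : ℝ}
    (hy : ∀ s ∈ Icc a b, ‖y s‖ ≤ (j : ℝ))
    (hη : ∀ s ∈ Icc a b, ∀ s' ∈ Icc a b, |s - s'| < 2 * δ → (ω j (nndist (y s) (y s')) : ℝ) ≤ η)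
    {n n' : ℕ} {t τ t' τ' : ℕ → ℝ} (hP : IsTaggedPartition δ a b n t τ)
    (hP' : IsTaggedPartition δ a b n' t' τ') :
    |riemannSum ν y n t τ - riemannSum ν y n' t' τ'| ≤ η * l.real (Ioc a b) := by
  have := hl.1.1
  set I : ℕ → Set ℝ := fun i => Ioc (t i) (t (i + 1)) with hI
  set I' : ℕ → Set ℝ := fun i => Ioc (t' i) (t' (i + 1)) with hI'
  have hlt := fun i hi => (hP.2.2 i hi).1
  have hlt' := fun i hi => (hP'.2.2 i hi).1
  have sI : ∀ i < n, I i ⊆ Ioc a b := by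
    intro i hi x hx
    have h1 := hP.Icc_subset hi (left_mem_Icc.2 (hlt i hi).le)
    have h2 := hP.Icc_subset hi (right_mem_Icc.2 (hlt i hi).le)
    exact ⟨h1.1.trans_lt hx.1, hx.2.trans h2.2⟩
  have sI' : ∀ i < n', I' i ⊆ Ioc a b := by
    intro i hi x hx
    have h1 := hP'.Icc_subset hi (left_mem_Icc.2 (hlt' i hi).le)
    have h2 := hP'.Icc_subset hi (right_mem_Icc.2 (hlt' i hi).le)
    exact ⟨h1.1.trans_lt hx.1, hx.2.trans h2.2⟩
  have e1 : riemannSum ν y n t τ =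
      ∑ i ∈ Finset.range n, ∑ k ∈ Finset.range n', ν (y (τ i)) (I i ∩ I' k) := by
    refine Finset.sum_congr rfl fun i hi => ?_
    have hi := Finset.mem_range.1 hi
    rw [BMeasure.Icc_eq_Ioc _ (hlt i hi).le,
      ← (sum_inter_Ioc (fun A B => (ν (y (τ i))).union) (isBddBorel_Ioc _ _) t' n' hlt').2,
      hP'.1, hP'.2.1, inter_eq_left.2 (sI i hi)]
  have e2 : riemannSum ν y n' t' τ' =
      ∑ i ∈ Finset.range n, ∑ k ∈ Finset.range n', ν (y (τ' k)) (I i ∩ I' k) := by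
    rw [Finset.sum_comm]
    refine Finset.sum_congr rfl fun k hk => ?_
    have hk := Finset.mem_range.1 hk
    simp_rw [inter_comm _ (I' k)]
    rw [BMeasure.Icc_eq_Ioc _ (hlt' k hk).le,
      ← (sum_inter_Ioc (fun A B => (ν (y (τ' k))).union) (isBddBorel_Ioc _ _) t n hlt).2,
      hP.1, hP.2.1, inter_eq_left.2 (sI' k hk)]
  have e3 : l.real (Ioc a b) =
      ∑ i ∈ Finset.range n, ∑ k ∈ Finset.range n', l.real (I i ∩ I' k) := by
    have hl1 : ∀ A B, IsBddBorel A → IsBddBorel B → Disjoint A B →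
        l.real (A ∪ B) = l.real A + l.real B := fun A B => measureReal_union_bdd l
    have h1 := (sum_inter_Ioc hl1 (isBddBorel_Ioc a b) t n hlt).2
    rw [hP.1, hP.2.1, inter_self] at h1
    rw [h1]
    refine Finset.sum_congr rfl fun i hi => ?_
    have hi := Finset.mem_range.1 hi
    rw [← (sum_inter_Ioc hl1 (isBddBorel_Ioc _ _) t' n' hlt').2, hP'.1, hP'.2.1,
      inter_eq_left.2 (sI i hi), inter_eq_right.2 (sI i hi)]
  rw [e1, e2, e3, ← Finset.sum_sub_distrib, Finset.mul_sum]
  refine (Finset.abs_sum_le_sum_abs _ _).trans (Finset.sum_le_sum fun i hi => ?_)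
  rw [← Finset.sum_sub_distrib, Finset.mul_sum]
  refine (Finset.abs_sum_le_sum_abs _ _).trans (Finset.sum_le_sum fun k hk => ?_)
  have hi := Finset.mem_range.1 hi
  have hk := Finset.mem_range.1 hk
  have m1 := hP.Icc_subset hi (hP.2.2 i hi).2.1
  have m2 := hP'.Icc_subset hk (hP'.2.2 k hk).2.1
  have hB : IsBddBorel (I i ∩ I' k) :=
    (isBddBorel_Ioc _ _).subset (measurableSet_Ioc.inter measurableSet_Ioc) inter_subset_left
  have h := abs_sub_apply_le hl hB (hy _ m1) (hy _ m2)
  rcases (I i ∩ I' k).eq_empty_or_nonempty with h0 | ⟨x, hx, hx'⟩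
  · rw [h0] at h ⊢
    simpa using h
  · refine h.trans ?_
    rw [mul_comm]
    refine mul_le_mul_of_nonneg_right (hη _ m1 _ m2 ?_) measureReal_nonneg
    obtain ⟨-, ⟨p1, p2⟩, p3⟩ := hP.2.2 i hi
    obtain ⟨-, ⟨q1, q2⟩, q3⟩ := hP'.2.2 k hk
    rw [abs_lt]
    constructor <;> linarith [hx.1, hx.2, hx'.1, hx'.2]

/-- A parametric b-measure is integrable along every continuous curve. -/
theorem exists_hasParamIntegral (ν : ParamBMeasure N ω) {y : ℝ → EuclideanSpace ℝ (Fin N)}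
    {a b : ℝ} (hab : a < b) (hy : ContinuousOn y (Icc a b)) :
    ∃ L, HasParamIntegral ν y a b L := by
  obtain ⟨C, hC⟩ := isCompact_Icc.exists_bound_of_continuousOn hy
  obtain ⟨j0, hj0⟩ := exists_nat_ge C
  let j : ℕ+ := j0.succPNat
  have hj : ∀ s ∈ Icc a b, ‖y s‖ ≤ (j : ℝ) := fun s hs => by
    have : ((j : ℕ) : ℝ) = j0 + 1 := by simp [j]
    rw [this]; linarith [hC s hs]
  obtain ⟨m, l, -, hl⟩ := ν.2 j
  have cauchy : ∀ ε > 0, ∃ δ > 0, ∀ (n : ℕ) (t τ : ℕ → ℝ) (n' : ℕ) (t' τ' : ℕ → ℝ),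
      IsTaggedPartition δ a b n t τ → IsTaggedPartition δ a b n' t' τ' →
      |riemannSum ν y n t τ - riemannSum ν y n' t' τ'| < ε := by
    intro ε hε
    set M := l.real (Ioc a b) with hM
    have hM0 : 0 ≤ M := measureReal_nonneg
    have hη : 0 < ε / (M + 1) := by positivity
    have hc : Tendsto (fun r => (ω j r : ℝ)) (𝓝 0) (𝓝 0) := by
      have := (NNReal.continuous_coe.comp (ω.continuous j)).tendsto 0
      simpa [Function.comp_def, ω.zero j] using this
    obtain ⟨ρ, hρ, Hρ⟩ := Metric.eventually_nhds_iff.1 (hc.eventually (gt_mem_nhds hη))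
    obtain ⟨δ, hδ, Hδ⟩ := Metric.uniformContinuousOn_iff.1
      (isCompact_Icc.uniformContinuousOn_of_continuous hy) ρ hρ
    refine ⟨δ / 2, half_pos hδ, fun n t τ n' t' τ' hP hP' => ?_⟩
    refine (abs_riemannSum_sub_le ν hl hj (η := ε / (M + 1)) ?_ hP hP').trans_lt ?_
    · intro s hs s' hs' hss
      refine (Hρ ?_).le
      have := Hδ s hs s' hs' (by rw [Real.dist_eq]; linarith)
      rw [NNReal.dist_eq]
      simpa using this
    · rw [div_mul_eq_mul_div, div_lt_iff₀ (by positivity)]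
      nlinarith
  choose n t τ hP using fun k : ℕ =>
    exists_taggedPartition hab (δ := 1 / ((k : ℝ) + 1)) (by positivity)
  have fine : ∀ δ > 0, ∃ K : ℕ, ∀ k ≥ K, IsTaggedPartition δ a b (n k) (t k) (τ k) := by
    intro δ hδ
    obtain ⟨K, hK⟩ := exists_nat_one_div_lt hδ
    refine ⟨K, fun k hk => (hP k).mono (le_trans ?_ hK.le)⟩
    exact one_div_le_one_div_of_le (by positivity) (by simpa using hk)
  have hS : CauchySeq fun k => riemannSum ν y (n k) (t k) (τ k) := by
    refine Metric.cauchySeq_iff.2 fun ε hε => ?_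
    obtain ⟨δ, hδ, H⟩ := cauchy ε hε
    obtain ⟨K, hK⟩ := fine δ hδ
    exact ⟨K, fun k hk k' hk' => H _ _ _ _ _ _ (hK k hk) (hK k' hk')⟩
  obtain ⟨L, hL⟩ := cauchySeq_tendsto_of_complete hS
  refine ⟨L, fun ε hε => ?_⟩
  obtain ⟨δ, hδ, H⟩ := cauchy (ε / 2) (half_pos hε)
  obtain ⟨K, hK⟩ := fine δ hδ
  refine ⟨δ, hδ, fun n' t' τ' hP' => ?_⟩
  obtain ⟨K', hK'⟩ := Metric.tendsto_atTop.1 hL (ε / 2) (half_pos hε)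
  have h1 := hK' (max K K') (le_max_right _ _)
  have h2 := H _ _ _ _ _ _ (hK (max K K') (le_max_left _ _)) hP'
  rw [Real.dist_eq, abs_sub_comm] at h1
  exact (abs_sub_le _ _ _).trans_lt (by linarith)

theorem hasParamIntegral_paramIntegral (ν : ParamBMeasure N ω)
    {y : ℝ → EuclideanSpace ℝ (Fin N)} {a b : ℝ} (hab : a < b) (hy : ContinuousOn y (Icc a b)) :
    HasParamIntegral ν y a b (paramIntegral ν y a b) := by
  obtain ⟨L, hL⟩ := exists_hasParamIntegral ν hab hy
  rwa [hL.eq hab]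

theorem abs_paramIntegral_le (ν : ParamBMeasure N ω) {j : ℕ+} {m : Measure ℝ}
    (hm : IsMBound ν j m) {y : ℝ → EuclideanSpace ℝ (Fin N)} {a b : ℝ} (hab : a < b)
    (hy : ContinuousOn y (Icc a b)) (hj : ∀ s ∈ Icc a b, ‖y s‖ ≤ (j : ℝ)) :
    |paramIntegral ν y a b| ≤ m.real (Ioc a b) := by
  have := hm.1.1
  refine le_of_forall_pos_le_add fun ε hε => ?_
  obtain ⟨δ, hδ, H⟩ := hasParamIntegral_paramIntegral ν hab hy ε hε
  obtain ⟨n, t, τ, hP⟩ := exists_taggedPartition hab hδ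
  have h1 := H n t τ hP
  have h2 : |riemannSum ν y n t τ| ≤ m.real (Ioc a b) := by
    have h3 := (sum_inter_Ioc (fun A B => measureReal_union_bdd m) (isBddBorel_Ioc a b) t n
      (fun i hi => (hP.2.2 i hi).1)).2
    rw [hP.1, hP.2.1, inter_self] at h3
    rw [h3]
    refine (Finset.abs_sum_le_sum_abs _ _).trans (Finset.sum_le_sum fun i hi => ?_)
    have hi := Finset.mem_range.1 hi
    have hsub : Ioc (t i) (t (i + 1)) ⊆ Ioc a b := by
      intro x hx
      have p1 := hP.Icc_subset hi (left_mem_Icc.2 (hP.2.2 i hi).1.le)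
      have p2 := hP.Icc_subset hi (right_mem_Icc.2 (hP.2.2 i hi).1.le)
      exact ⟨p1.1.trans_lt hx.1, hx.2.trans p2.2⟩
    rw [BMeasure.Icc_eq_Ioc _ (hP.2.2 i hi).1.le, inter_eq_right.2 hsub]
    exact abs_apply_le hm (isBddBorel_Ioc _ _) (hj _ (hP.Icc_subset hi (hP.2.2 i hi).2.1))
  have := abs_sub_abs_le_abs_sub (paramIntegral ν y a b) (riemannSum ν y n t τ)
  linarith

theorem paramIntegral_add (ν₁ ν₂ : ParamBMeasure N ω) {y : ℝ → EuclideanSpace ℝ (Fin N)}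
    {a b : ℝ} (hab : a < b) (hy : ContinuousOn y (Icc a b)) :
    paramIntegral (ν₁ + ν₂) y a b = paramIntegral ν₁ y a b + paramIntegral ν₂ y a b :=
  ((hasParamIntegral_paramIntegral ν₁ hab hy).add
    (hasParamIntegral_paramIntegral ν₂ hab hy)).eq hab

theorem paramIntegral_smul (c : ℝ) (ν : ParamBMeasure N ω) {y : ℝ → EuclideanSpace ℝ (Fin N)}
    {a b : ℝ} (hab : a < b) (hy : ContinuousOn y (Icc a b)) :
    paramIntegral (c • ν) y a b = c * paramIntegral ν y a b :=
  ((hasParamIntegral_paramIntegral ν hab hy).smul c).eq hab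

/-! ### The topologies `σ_D` and `σ_Θ` -/

/-- The compact intervals `[q₁, q₂]` with rational endpoints `q₁ < q₂`. -/
structure RatInterval where
  left : ℚ
  right : ℚ
  lt : left < right

/-- The interval as a set of real numbers. -/
def RatInterval.set (I : RatInterval) : Set ℝ := Icc (I.left : ℝ) (I.right : ℝ)

theorem RatInterval.lt_real (I : RatInterval) : (I.left : ℝ) < (I.right : ℝ) :=
  Rat.cast_lt.2 I.lt

/-- A suitable set of moduli of continuity `Θ = {θ_j^I}`. -/
structure SuitableModuli where
  toFun : RatInterval → ℕ+ → ℝ≥0 → ℝ≥0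
  continuous : ∀ I j, Continuous (toFun I j)
  monotone : ∀ I j, Monotone (toFun I j)
  zero : ∀ I j, toFun I j 0 = 0
  le_of_le : ∀ ⦃I₁ I₂ : RatInterval⦄ ⦃j₁ j₂ : ℕ+⦄, I₁.set ⊆ I₂.set → j₁ ≤ j₂ →
    ∀ r, toFun I₁ j₁ r ≤ toFun I₂ j₂ r

instance : CoeFun SuitableModuli (fun _ => RatInterval → ℕ+ → ℝ≥0 → ℝ≥0) :=
  ⟨SuitableModuli.toFun⟩

/-- The set `K_j^I` of continuous curves `I → B_j` with modulus of continuity `θ_j^I`. -/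
def SuitableModuli.curves (Θ : SuitableModuli) (N : ℕ) (I : RatInterval) (j : ℕ+) :
    Set (ℝ → EuclideanSpace ℝ (Fin N)) :=
  {y | ContinuousOn y I.set ∧ (∀ s ∈ I.set, ‖y s‖ ≤ (j : ℝ)) ∧
    ∀ s₁ ∈ I.set, ∀ s₂ ∈ I.set, nndist (y s₁) (y s₂) ≤ Θ I j (nndist s₁ s₂)}

theorem bddAbove_paramIntegral (Θ : SuitableModuli) (I : RatInterval) (j : ℕ+)
    (ν : ParamBMeasure N ω) :
    BddAbove (range fun y : Θ.curves N I j => |paramIntegral ν y.1 I.left I.right|) := by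
  obtain ⟨m, -, hm, -⟩ := ν.2 j
  refine ⟨m.real (Ioc (I.left : ℝ) I.right), ?_⟩
  rintro _ ⟨y, rfl⟩
  exact abs_paramIntegral_le ν hm I.lt_real y.2.1 y.2.2.1

/-- The seminorm `p_{I,y}(ν) = |∫_I dν_y| = |ν_y(I)|`. -/
def seminormD (y : EuclideanSpace ℝ (Fin N)) (I : RatInterval) :
    Seminorm ℝ (ParamBMeasure N ω) :=
  Seminorm.of (fun ν => |ν y I.set|)
    (fun ν₁ ν₂ => by rw [ParamBMeasure.add_apply]; exact abs_add_le _ _)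
    (fun c ν => by rw [ParamBMeasure.smul_apply, abs_mul, Real.norm_eq_abs])

/-- The seminorm `p_{I,j}(ν) = sup_{y ∈ K_j^I} |∫_I dν_{y(s)}|`. -/
def seminormTheta (Θ : SuitableModuli) (I : RatInterval) (j : ℕ+) :
    Seminorm ℝ (ParamBMeasure N ω) :=
  Seminorm.of (fun ν => ⨆ y : Θ.curves N I j, |paramIntegral ν y.1 I.left I.right|)
    (fun ν₁ ν₂ => by
      refine Real.iSup_le (fun y => ?_) (add_nonneg (Real.iSup_nonneg fun _ => abs_nonneg _)
        (Real.iSup_nonneg fun _ => abs_nonneg _))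
      rw [paramIntegral_add _ _ I.lt_real y.2.1]
      exact (abs_add_le _ _).trans (add_le_add (le_ciSup (bddAbove_paramIntegral Θ I j ν₁) y)
        (le_ciSup (bddAbove_paramIntegral Θ I j ν₂) y)))
    (fun c ν => by
      rw [Real.norm_eq_abs, Real.mul_iSup_of_nonneg (abs_nonneg c)]
      refine iSup_congr fun y => ?_
      rw [paramIntegral_smul c ν I.lt_real y.2.1, abs_mul])

/-- The topology on a real vector space generated by a family of seminorms: the coarsest one that
is finer than each of the topologies given by a single seminorm. -/
abbrev seminormTopology {V ι : Type*} [AddCommGroup V] [Module ℝ V] (p : ι → Seminorm ℝ V) :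
    TopologicalSpace V :=
  ⨅ i, (p i).toSeminormedAddCommGroup.toUniformSpace.toTopologicalSpace

/-- The topology `σ_D` on the space of parametric b-measures. -/
abbrev sigmaD (N : ℕ) (ω : ModulusFamily) (D : Set (EuclideanSpace ℝ (Fin N))) :
    TopologicalSpace (ParamBMeasure N ω) :=
  seminormTopology fun q : D × RatInterval => seminormD q.1.1 q.2

/-- The topology `σ_Θ` on the space of parametric b-measures. -/
abbrev sigmaTheta (N : ℕ) (ω : ModulusFamily) (Θ : SuitableModuli) :
    TopologicalSpace (ParamBMeasure N ω) :=
  seminormTopology fun q : RatInterval × ℕ+ => seminormTheta Θ q.1 q.2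

/-- `T` is one of the topologies `σ_D`, with `D` countable and dense in `ℝ^N`, or `σ_Θ`, with `Θ` a
suitable set of moduli of continuity. -/
def IsSigmaTopology (T : TopologicalSpace (ParamBMeasure N ω)) : Prop :=
  (∃ D : Set (EuclideanSpace ℝ (Fin N)), D.Countable ∧ Dense D ∧ T = sigmaD N ω D) ∨
    ∃ Θ : SuitableModuli, T = sigmaTheta N ω Θ

/-! ### Families with equicontinuous `m`-bounds and bounded `l`-bounds -/

/-- A bounded family of measures on the line. -/
def BoundedMeasures {Γ : Type*} (μ : Γ → Measure ℝ) : Prop :=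
  ∃ c : ℝ, 0 < c ∧ ∀ α t, μ α (Icc t (t + 1)) ≤ ENNReal.ofReal c

/-- An equicontinuous family of measures on the line. -/
def EquicontinuousMeasures {Γ : Type*} (μ : Γ → Measure ℝ) : Prop :=
  ∀ ε : ℝ, 0 < ε → ∃ δ : ℝ, 0 < δ ∧ ∀ α s t, 0 ≤ t - s → t - s < δ →
    μ α (Icc s t) < ENNReal.ofReal ε

/-- The set `E` has equicontinuous `m`-bounds. -/
def HasEquicontinuousMBounds (E : Set (ParamBMeasure N ω)) : Prop :=
  ∃ m : E → ℕ+ → Measure ℝ, (∀ ν j, IsMBound ν.1 j (m ν j)) ∧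
    ∀ j, EquicontinuousMeasures fun ν => m ν j

/-- The set `E` has bounded `l`-bounds. -/
def HasBoundedLBounds (E : Set (ParamBMeasure N ω)) : Prop :=
  ∃ l : E → ℕ+ → Measure ℝ, (∀ ν j, IsLBound ω ν.1 j (l ν j)) ∧
    ∀ j, BoundedMeasures fun ν => l ν j

end

/-! ### Carathéodory vector fields -/

/-- `g` is a Carathéodory vector field on `ℝ^N`: it is Lebesgue measurable in `t` for each `y` and
continuous in `y` for almost every `t`, and on the closed ball of radius `j` it has the locally
integrable `m`-bound `m j`, and the locally integrable `l`-bound `l j` with respect to the modulus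
of continuity `ω j` (`ω j = id` being the Lipschitz case). -/
structure IsCaratheodory {N : ℕ} (ω : ModulusFamily)
    (g : EuclideanSpace ℝ (Fin N) → ℝ → EuclideanSpace ℝ (Fin N)) (m l : ℕ+ → ℝ → ℝ) : Prop where
  measurable : ∀ y, AEMeasurable (g y) volume
  continuous : ∀ᵐ t : ℝ, Continuous fun y => g y t
  m_nonneg : ∀ j t, 0 ≤ m j t
  l_nonneg : ∀ j t, 0 ≤ l j t
  m_locallyIntegrable : ∀ j, LocallyIntegrable (m j) volume
  l_locallyIntegrable : ∀ j, LocallyIntegrable (l j) volume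
  m_bound : ∀ j : ℕ+, ∀ᵐ t : ℝ, ∀ y, ‖y‖ ≤ (j : ℝ) → ‖g y t‖ ≤ m j t
  l_bound : ∀ j : ℕ+, ∀ᵐ t : ℝ, ∀ y₁ y₂, ‖y₁‖ ≤ (j : ℝ) → ‖y₂‖ ≤ (j : ℝ) →
    ‖g y₁ t - g y₂ t‖ ≤ l j t * ω j (nndist y₁ y₂)

/-- A family of Carathéodory vector fields has equicontinuous `m`-bounds and bounded `l`-bounds. -/
def IsBoundedCaratheodoryFamily {N : ℕ} (ω : ModulusFamily) {Γ : Type*}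
    (g : Γ → EuclideanSpace ℝ (Fin N) → ℝ → EuclideanSpace ℝ (Fin N)) : Prop :=
  ∃ m l : Γ → ℕ+ → ℝ → ℝ, (∀ α, IsCaratheodory ω (g α) (m α) (l α)) ∧
    (∀ j, ∀ ε : ℝ, 0 < ε → ∃ δ : ℝ, 0 < δ ∧ ∀ α s h, 0 ≤ h → h < δ →
      ∫ t in s..(s + h), m α j t < ε) ∧
    ∀ j, ∃ c : ℝ, 0 < c ∧ ∀ α s, ∫ t in s..(s + 1), l α j t ≤ c

end

/-!
Along an ultrafilter, the values `ν_y((s, t])` of a family of parametric b-measures converge, and so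
do the interval values of the equicontinuous `m`-bounds and of the bounded `l`-bounds. The limits of
the latter are increments of non-decreasing functions. For the `m`-bounds these functions are
continuous, so the limit of the `ν_y` is again the interval function of a b-measure, and it is
dominated by their Stieltjes measures. For the `l`-bounds they may jump, but b-measures vanish on
countable sets, so the non-atomic part of their Stieltjes measures is still an `l`-bound of the
limit.

Conversely, convergence of the interval values implies convergence in `σ_D` and `σ_Θ`: replacing a
curve with modulus of continuity `θ_j^I` by a step function with values in a finite net of `B_j`
changes its integral over `I` by at most `ε l(I)`, so that the seminorms of `σ_Θ` are controlled by
finitely many interval values, uniformly for bounded `l`-bounds. Thus every ultrafilter on the index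
set of the family converges along it, and in a regular space this makes the closure of the range
compact.
-/

noncomputable section

section Topology

theorem isCompact_closure_range_of_ultrafilter {ι X : Type*} [TopologicalSpace X] [RegularSpace X]
    {f : ι → X} (h : ∀ V : Ultrafilter ι, ∃ x, Tendsto f V (𝓝 x)) :
    IsCompact (closure (range f)) := by
  choose g hg using h
  have hgc : Continuous g := continuous_iff_continuousAt.2 fun V =>
    (closed_nhds_basis (g V)).tendsto_right_iff.2 fun C ⟨hC, hCc⟩ =>
      ((ultrafilter_isOpen_basic (f ⁻¹' C)).eventually_mem (hg V hC)).mono fun W hW =>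
        hCc.mem_of_tendsto (hg W) hW
  refine (isCompact_range hgc).closure.closure_of_subset ?_
  rintro _ ⟨i, rfl⟩
  have hi : f i ⤳ g (pure i) := specializes_iff_pure.2 (hg (pure i))
  exact hi.symm.mem_closed isClosed_closure (subset_closure (mem_range_self _))

theorem exists_tendsto_ultrafilter_of_abs_le {ι : Type*} (V : Ultrafilter ι) {f : ι → ℝ} {C : ℝ}
    (h : ∀ i, |f i| ≤ C) : ∃ L, Tendsto f V (𝓝 L) := by
  obtain ⟨L, -, hL⟩ := (isCompact_Icc (a := -C) (b := C)).ultrafilter_le_nhds' (V.map f)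
    (Ultrafilter.mem_map.2 (Eventually.of_forall fun i => abs_le.1 (h i)))
  exact ⟨L, hL⟩

variable {W ι : Type*} [AddCommGroup W] [Module ℝ W] (p : ι → Seminorm ℝ W)

theorem regularSpace_seminormTopology : @RegularSpace W (seminormTopology p) :=
  regularSpace_iInf fun i =>
    let := (p i).toSeminormedAddCommGroup
    inferInstance

theorem tendsto_seminormTopology {α : Type*} {l : Filter α} {u : α → W} {x : W} :
    Tendsto u l (@nhds W (seminormTopology p) x) ↔
      ∀ i, Tendsto (fun a => p i (u a - x)) l (𝓝 0) := by
  rw [nhds_iInf, tendsto_iInf]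
  refine forall_congr' fun i => ?_
  let := (p i).toSeminormedAddCommGroup
  exact tendsto_iff_norm_sub_tendsto_zero

end Topology

section Dominated

variable {α : Type*} [LinearOrder α] {F G : α → ℝ}

theorem abs_sub_le_abs_sub_of_dominated (h : ∀ s t, s ≤ t → |G t - G s| ≤ F t - F s) (s t : α) :
    |G t - G s| ≤ |F t - F s| := by
  rcases le_total s t with hst | hst
  · exact (h s t hst).trans (le_abs_self _)
  · rw [abs_sub_comm, abs_sub_comm (F t)]
    exact (h t s hst).trans (le_abs_self _)

theorem continuousWithinAt_of_dominated [TopologicalSpace α]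
    (h : ∀ s t, s ≤ t → |G t - G s| ≤ F t - F s) {A : Set α} {x : α}
    (hF : ContinuousWithinAt F A x) : ContinuousWithinAt G A x :=
  tendsto_iff_dist_tendsto_zero.2 (squeeze_zero (fun _ => dist_nonneg)
    (fun y => abs_sub_le_abs_sub_of_dominated h x y) (tendsto_iff_dist_tendsto_zero.1 hF))

theorem continuous_of_dominated [TopologicalSpace α]
    (h : ∀ s t, s ≤ t → |G t - G s| ≤ F t - F s) (hF : Continuous F) : Continuous G :=
  continuous_iff_continuousAt.2 fun x => (continuousWithinAt_univ G x).1
    (continuousWithinAt_of_dominated h hF.continuousWithinAt)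

/-- The sum of a Stieltjes function `F` and a function `G` whose increments are dominated by those
of `F`. Its measure is the measure of `F` plus the set function with primitive `G`. -/
def dominatedAdd (F : StieltjesFunction ℝ) (G : ℝ → ℝ)
    (h : ∀ s t, s ≤ t → |G t - G s| ≤ F t - F s) : StieltjesFunction ℝ where
  toFun t := F t + G t
  mono' s t hst := by linarith [(abs_le.1 (h s t hst)).1]
  right_continuous' x :=
    (F.right_continuous x).add (continuousWithinAt_of_dominated h (F.right_continuous x))

theorem dominatedAdd_apply (F : StieltjesFunction ℝ) {G : ℝ → ℝ}
    (h : ∀ s t, s ≤ t → |G t - G s| ≤ F t - F s) (t : ℝ) : dominatedAdd F G h t = F t + G t := rfl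

end Dominated

section Stieltjes

theorem isContinuousMeasure_stieltjes {F : StieltjesFunction ℝ} (hF : Continuous F) :
    IsContinuousMeasure F.measure :=
  ⟨inferInstance, fun t => by
    rw [F.measure_singleton, hF.continuousWithinAt.leftLim_eq, sub_self, ENNReal.ofReal_zero]⟩

theorem stieltjes_measureReal_Ioc (F : StieltjesFunction ℝ) {s t : ℝ} (h : s ≤ t) :
    F.measure.real (Ioc s t) = F t - F s := by
  rw [measureReal_def, F.measure_Ioc, ENNReal.toReal_ofReal (sub_nonneg.2 (F.mono h))]

theorem abs_sub_le_mul_rightLim {F G : ℝ → ℝ} (hG : Continuous G) (hF : Monotone F) {k : ℝ}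
    (h : ∀ s t, s ≤ t → |G t - G s| ≤ k * (F t - F s)) {s t : ℝ} (hst : s ≤ t) :
    |G t - G s| ≤ k * (hF.stieltjesFunction t - hF.stieltjesFunction s) := by
  have shift (u : ℝ) : Tendsto (fun e : ℝ => u + e) (𝓝[>] 0) (𝓝[>] u) := by
    simpa using (tendsto_map (f := fun e : ℝ => u + e) (x := 𝓝[>] 0))
  have tendsto_F (u : ℝ) : Tendsto (fun e => F (u + e)) (𝓝[>] 0) (𝓝 (hF.stieltjesFunction u)) :=
    (hF.tendsto_rightLim u).comp (shift u)
  have tendsto_G (u : ℝ) : Tendsto (fun e => G (u + e)) (𝓝[>] 0) (𝓝 (G u)) :=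
    ((hG.tendsto u).mono_left nhdsWithin_le_nhds).comp (shift u)
  exact le_of_tendsto_of_tendsto' ((tendsto_G t).sub (tendsto_G s)).abs
    (((tendsto_F t).sub (tendsto_F s)).const_mul k) fun e => h _ _ (add_le_add_left hst e)

theorem exists_countable_isContinuousMeasure_restrict_compl (m : Measure ℝ)
    [IsLocallyFiniteMeasure m] :
    ∃ S : Set ℝ, S.Countable ∧ IsContinuousMeasure (m.restrict Sᶜ) := by
  refine ⟨{t | 0 < m {t}}, ?_, inferInstance, fun t => ?_⟩
  · exact Measure.countable_meas_pos_of_disjoint_iUnion (fun t => measurableSet_singleton t)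
      fun s t hst => by simpa using hst
  · rw [Measure.restrict_apply (measurableSet_singleton t)]
    by_cases ht : 0 < m {t}
    · rw [singleton_inter_eq_empty.2 (by simpa using ht.ne'), measure_empty]
    · exact measure_mono_null inter_subset_left (by simpa using ht)

end Stieltjes

namespace IsBddBorel

variable {A : Set ℝ}

theorem measure_ne_top (hA : IsBddBorel A) (m : Measure ℝ) [IsLocallyFiniteMeasure m] :
    m A ≠ ∞ := hA.2.measure_lt_top.ne

theorem exists_subset_Ioc (hA : IsBddBorel A) : ∃ a b : ℝ, a ≤ b ∧ A ⊆ Ioc a b := by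
  obtain ⟨r, hr, hAr⟩ := hA.2.subset_ball_lt 0 0
  rw [Real.ball_eq_Ioo] at hAr
  exact ⟨_, _, by linarith, hAr.trans Ioo_subset_Ioc_self⟩

end IsBddBorel

namespace BMeasure

open Classical in
/-- The b-measure given by a set function that is countably additive on bounded Borel sets and
vanishes on points; the values off the ring of bounded Borel sets are discarded. -/
def mk (f : Set ℝ → ℝ) (empty : f ∅ = 0)
    (hasSum : ∀ A : ℕ → Set ℝ, (∀ n, IsBddBorel (A n)) →
      Pairwise (fun m n => Disjoint (A m) (A n)) → IsBddBorel (⋃ n, A n) →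
        HasSum (fun n => f (A n)) (f (⋃ n, A n)))
    (singleton : ∀ t, f {t} = 0) : BMeasure :=
  ⟨fun A => if IsBddBorel A then f A else 0, fun _ hA => if_neg hA, by simp [empty],
    fun A hA hd hU => by simpa only [if_pos hU, if_pos (hA _)] using hasSum A hA hd hU,
    fun t => by simp [singleton]⟩

theorem mk_apply {f : Set ℝ → ℝ} {h₀ h h₁} {A : Set ℝ} (hA : IsBddBorel A) :
    mk f h₀ h h₁ A = f A := if_pos hA

/-- A locally finite measure without atoms as a b-measure. -/
def ofMeasure (m : Measure ℝ) (hm : IsContinuousMeasure m) : BMeasure :=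
  mk m.real (by simp)
    (fun A hA hd hU => by
      have := hm.1
      have hsum : ∑' n, m (A n) ≠ ∞ := by
        rw [← measure_iUnion hd fun n => (hA n).1]
        exact hU.measure_ne_top m
      simp only [measureReal_def]
      rw [measure_iUnion hd fun n => (hA n).1,
        ENNReal.tsum_toReal_eq fun n => (hA n).measure_ne_top m]
      exact (ENNReal.summable_toReal hsum).hasSum)
    (fun t => by simp [measureReal_def, hm.2 t])

theorem ofMeasure_apply {m : Measure ℝ} (hm : IsContinuousMeasure m) {A : Set ℝ}
    (hA : IsBddBorel A) : ofMeasure m hm A = m.real A := mk_apply hA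

variable (μ : BMeasure)

open Classical in
/-- The restriction of a b-measure to a bounded Borel set, as a signed measure on the line; it makes
the theory of vector measures available. -/
def restrict {B : Set ℝ} (hB : IsBddBorel B) : SignedMeasure ℝ where
  measureOf' A := if MeasurableSet A then μ (A ∩ B) else 0
  empty' := by simpa using μ.2.2.1
  not_measurable' _ hA := if_neg hA
  m_iUnion' A hA hd := by
    have hsub : ∀ C, MeasurableSet C → IsBddBorel (C ∩ B) := fun C hC =>
      hB.subset (hC.inter hB.1) inter_subset_right
    simp only [hA, MeasurableSet.iUnion hA, if_true]
    rw [iUnion_inter]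
    exact μ.2.2.2.1 _ (fun n => hsub _ (hA n))
      (fun m n hmn => (hd hmn).mono inter_subset_left inter_subset_left)
      (iUnion_inter B A ▸ hsub _ (MeasurableSet.iUnion hA))

theorem restrict_apply {A B : Set ℝ} (hB : IsBddBorel B) (hA : MeasurableSet A) :
    μ.restrict hB A = μ (A ∩ B) := if_pos hA

theorem empty_apply : μ ∅ = 0 := μ.2.2.1

theorem apply_eq_zero_of_countable {S : Set ℝ} (hS : S.Countable) (hb : IsBddBorel S) :
    μ S = 0 := by
  have := hS.to_subtype
  have hsing (t : S) : μ.restrict hb {(t : ℝ)} = 0 := by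
    rw [restrict_apply _ _ (measurableSet_singleton _),
      inter_eq_left.2 (singleton_subset_iff.2 t.2)]
    exact μ.2.2.2.2 t
  have hU : μ.restrict hb (⋃ t : S, {(t : ℝ)}) = ∑' t : S, μ.restrict hb {(t : ℝ)} :=
    VectorMeasure.of_disjoint_iUnion (fun t => measurableSet_singleton _)
      fun s t hst => by simpa [Function.onFun, Subtype.ext_iff] using hst
  rwa [iUnion_of_singleton_coe, restrict_apply _ _ hb.1, inter_self, tsum_congr hsing,
    tsum_zero] at hU

theorem apply_diff_countable {A S : Set ℝ} (hA : IsBddBorel A) (hS : S.Countable) :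
    μ (A \ S) = μ A := by
  have hdiff : IsBddBorel (A \ S) := hA.subset (hA.1.diff hS.measurableSet) sdiff_subset
  have hinter : IsBddBorel (A ∩ S) := hA.subset (hA.1.inter hS.measurableSet) inter_subset_left
  conv_rhs => rw [← sdiff_union_inter A S]
  rw [μ.union hdiff hinter disjoint_sdiff_inter,
    μ.apply_eq_zero_of_countable (hS.mono inter_subset_right) hinter, add_zero]

theorem Ioc_add {s t u : ℝ} (h₁ : s ≤ t) (h₂ : t ≤ u) :
    μ (Ioc s t) + μ (Ioc t u) = μ (Ioc s u) := by
  rw [← Ioc_union_Ioc_eq_Ioc h₁ h₂]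
  exact (μ.union (isBddBorel_Ioc _ _) (isBddBorel_Ioc _ _) (Ioc_disjoint_Ioc_of_le le_rfl)).symm

theorem add_measureReal_eq {p q : Measure ℝ} [IsLocallyFiniteMeasure p] [IsLocallyFiniteMeasure q]
    (h : ∀ s t, s ≤ t → μ (Ioc s t) + p.real (Ioc s t) = q.real (Ioc s t)) {A : Set ℝ}
    (hA : IsBddBorel A) : μ A + p.real A = q.real A := by
  obtain ⟨a, b, hab, hAb⟩ := hA.exists_subset_Ioc
  have hJ := isBddBorel_Ioc a b
  have : IsFiniteMeasure (p.restrict (Ioc a b)) :=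
    ⟨by simpa using (hJ.measure_ne_top p).lt_top⟩
  have : IsFiniteMeasure (q.restrict (Ioc a b)) :=
    ⟨by simpa using (hJ.measure_ne_top q).lt_top⟩
  set signed := μ.restrict hJ + (p.restrict (Ioc a b)).toSignedMeasure
  have happly : ∀ B, MeasurableSet B →
      signed B = μ (B ∩ Ioc a b) + p.real (B ∩ Ioc a b) := fun B hB => by
    rw [_root_.add_apply, restrict_apply _ _ hB,
      Measure.toSignedMeasure_apply_measurable hB, measureReal_restrict_apply hB]
  have happly' : ∀ B, MeasurableSet B →
      (q.restrict (Ioc a b)).toSignedMeasure B = q.real (B ∩ Ioc a b) := fun B hB => by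
    rw [Measure.toSignedMeasure_apply_measurable hB, measureReal_restrict_apply hB]
  have heq : signed = (q.restrict (Ioc a b)).toSignedMeasure := by
    refine VectorMeasure.ext_of_generateFrom _ ?_
      ((BorelSpace.measurable_eq (α := ℝ)).trans (borel_eq_generateFrom_Ioc ℝ))
      (isPiSystem_Ioc id id) ?_
    · rintro _ ⟨s, t, -, rfl⟩
      rw [happly _ measurableSet_Ioc, happly' _ measurableSet_Ioc, Ioc_inter_Ioc]
      rcases le_total (s ⊔ a) (t ⊓ b) with hle | hle
      · exact h _ _ hle
      · simpa [Ioc_eq_empty_of_le hle] using μ.2.2.1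
    · rw [happly _ .univ, happly' _ .univ, univ_inter]
      exact h a b hab
  have := happly A hA.1
  rwa [heq, happly' A hA.1, inter_eq_left.2 hAb, eq_comm] at this

end BMeasure

theorem exists_primitive_of_additive {α M : Type*} [LinearOrder α] [AddCommGroup M]
    (g : α → α → M) (h : ∀ s t u, s ≤ t → t ≤ u → g s t + g t u = g s u) :
    ∃ G : α → M, ∀ s t, s ≤ t → g s t = G t - G s := by
  rcases isEmpty_or_nonempty α with _ | ⟨⟨c⟩⟩
  · exact ⟨fun _ => 0, fun s => isEmptyElim s⟩
  refine ⟨fun t => if c ≤ t then g c t else -g t c, fun s t hst => ?_⟩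
  by_cases hs : c ≤ s
  · simp only [if_pos hs, if_pos (hs.trans hst), ← h c s t hs hst, add_sub_cancel_left]
  · have hs' := (not_le.1 hs).le
    by_cases ht : c ≤ t
    · simp only [if_neg hs, if_pos ht, ← h s c t hs' ht, sub_neg_eq_add, add_comm]
    · simp only [if_neg hs, if_neg ht, ← h s t c hst (not_le.1 ht).le]
      abel

namespace BMeasure

variable {μ : BMeasure}

theorem neg_apply (μ : BMeasure) (A : Set ℝ) : (-μ) A = -μ A := rfl

theorem abs_apply_le_of_Ioc {F : StieltjesFunction ℝ}
    (h : ∀ s t, s ≤ t → |μ (Ioc s t)| ≤ F t - F s) {A : Set ℝ} (hA : IsBddBorel A) :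
    |μ A| ≤ F.measure.real A := by
  have nonneg_add (κ : BMeasure) (hκ : ∀ s t, s ≤ t → |κ (Ioc s t)| ≤ F t - F s) :
      0 ≤ κ A + F.measure.real A := by
    obtain ⟨G, hG⟩ := exists_primitive_of_additive (fun s t => κ (Ioc s t)) fun s t u => κ.Ioc_add
    have hGF (s t : ℝ) (hst : s ≤ t) : |G t - G s| ≤ F t - F s := hG s t hst ▸ hκ s t hst
    rw [κ.add_measureReal_eq (q := (dominatedAdd F G hGF).measure) (fun s t hst => ?_) hA]
    · exact measureReal_nonneg
    · rw [stieltjes_measureReal_Ioc _ hst, stieltjes_measureReal_Ioc _ hst, hG s t hst,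
        dominatedAdd_apply, dominatedAdd_apply]
      ring
  have h₁ := nonneg_add μ h
  have h₂ := nonneg_add (-μ) fun s t hst => by simpa only [neg_apply, abs_neg] using h s t hst
  rw [neg_apply] at h₂
  exact abs_le.2 ⟨by linarith, by linarith⟩

theorem variation_le {m : Measure ℝ} [IsLocallyFiniteMeasure m]
    (h : ∀ A, IsBddBorel A → |μ A| ≤ m.real A) (A : Set ℝ) : μ.variation A ≤ m A := by
  refine iSup_le fun n => iSup_le fun P => iSup_le fun ⟨hP, hd, hU⟩ => ?_
  rw [← hU, measure_iUnion hd fun i => (hP i).1, tsum_fintype]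
  exact Finset.sum_le_sum fun i _ =>
    (ENNReal.ofReal_le_ofReal (h _ (hP i))).trans ENNReal.ofReal_toReal_le

theorem exists_of_primitive {F : StieltjesFunction ℝ} (hF : Continuous F) {G : ℝ → ℝ}
    (h : ∀ s t, s ≤ t → |G t - G s| ≤ F t - F s) :
    ∃ μ : BMeasure, ∀ s t, s ≤ t → μ (Ioc s t) = G t - G s := by
  have hFG : Continuous (dominatedAdd F G h) := hF.add (continuous_of_dominated h hF)
  refine ⟨ofMeasure _ (isContinuousMeasure_stieltjes hFG) -
    ofMeasure _ (isContinuousMeasure_stieltjes hF), fun s t hst => ?_⟩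
  rw [sub_apply, ofMeasure_apply _ (isBddBorel_Ioc s t), ofMeasure_apply _ (isBddBorel_Ioc s t),
    stieltjes_measureReal_Ioc _ hst, stieltjes_measureReal_Ioc _ hst, dominatedAdd_apply,
    dominatedAdd_apply]
  ring

end BMeasure

section Bounds

variable {N : ℕ} {ω : ModulusFamily} {ν : EuclideanSpace ℝ (Fin N) → BMeasure} {j : ℕ+}

theorem isMBound_of_abs_le {m : Measure ℝ} (hm : IsContinuousMeasure m)
    (h : ∀ A, IsBddBorel A → ∀ y, ‖y‖ ≤ (j : ℝ) → |ν y A| ≤ m.real A) : IsMBound ν j m :=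
  ⟨hm, fun A _ y hy =>
    have := hm.1
    BMeasure.variation_le (fun B hB => h B hB y hy) A⟩

theorem isLBound_of_abs_sub_le {l : Measure ℝ} (hl : IsContinuousMeasure l)
    (h : ∀ A, IsBddBorel A → ∀ y₁ y₂, ‖y₁‖ ≤ (j : ℝ) → ‖y₂‖ ≤ (j : ℝ) →
      |ν y₁ A - ν y₂ A| ≤ l.real A * ω j (nndist y₁ y₂)) : IsLBound ω ν j l := by
  refine ⟨hl, fun A _ y₁ y₂ h₁ h₂ => ?_⟩
  have := (hl.smul (ω j (nndist y₁ y₂))).1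
  rw [mul_comm, ← smul_eq_mul, ← Measure.smul_apply]
  refine BMeasure.variation_le (fun B hB => ?_) A
  rw [measureReal_ennreal_smul_apply, ENNReal.coe_toReal, mul_comm]
  exact h B hB y₁ y₂ h₁ h₂

theorem isMBound_of_Ioc {F : StieltjesFunction ℝ} (hF : Continuous F)
    (h : ∀ y, ‖y‖ ≤ (j : ℝ) → ∀ s t, s ≤ t → |ν y (Ioc s t)| ≤ F t - F s) :
    IsMBound ν j F.measure :=
  isMBound_of_abs_le (isContinuousMeasure_stieltjes hF) fun _ hA y hy =>
    BMeasure.abs_apply_le_of_Ioc (h y hy) hA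

theorem exists_isLBound_of_Ioc (H : StieltjesFunction ℝ)
    (h : ∀ y₁ y₂, ‖y₁‖ ≤ (j : ℝ) → ‖y₂‖ ≤ (j : ℝ) → ∀ s t, s ≤ t →
      |ν y₁ (Ioc s t) - ν y₂ (Ioc s t)| ≤ ω j (nndist y₁ y₂) * (H t - H s)) :
    ∃ l, IsLBound ω ν j l := by
  -- `H` may jump; its jumps can be dropped because b-measures ignore countable sets.
  obtain ⟨S, hS, hSc⟩ := exists_countable_isContinuousMeasure_restrict_compl H.measure
  refine ⟨_, isLBound_of_abs_sub_le hSc fun A hA y₁ y₂ h₁ h₂ => ?_⟩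
  have hAS : IsBddBorel (A \ S) := hA.subset (hA.1.diff hS.measurableSet) sdiff_subset
  have hle := BMeasure.abs_apply_le_of_Ioc (μ := ν y₁ - ν y₂) (F := ω j (nndist y₁ y₂) • H)
    (fun s t hst => (h y₁ y₂ h₁ h₂ s t hst).trans_eq (mul_sub ..)) hAS
  rwa [BMeasure.apply_diff_countable _ hA hS, StieltjesFunction.measure_smul,
    measureReal_nnreal_smul_apply, mul_comm, sdiff_eq,
    ← measureReal_restrict_apply hA.1] at hle

end Bounds

theorem exists_norm_le_pnat {E : Type*} [Norm E] (y : E) : ∃ j : ℕ+, ‖y‖ ≤ (j : ℝ) := by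
  obtain ⟨n, hn⟩ := exists_nat_ge ‖y‖
  exact ⟨n.succPNat, hn.trans (by simp)⟩

namespace ParamBMeasure

variable {N : ℕ} {ω : ModulusFamily}

theorem exists_of_primitives {G : EuclideanSpace ℝ (Fin N) → ℝ → ℝ} {F H : ℕ+ → ℝ → ℝ}
    (hFc : ∀ j, Continuous (F j)) (hFm : ∀ j, Monotone (F j)) (hHm : ∀ j, Monotone (H j))
    (hF : ∀ (j : ℕ+) (y), ‖y‖ ≤ (j : ℝ) → ∀ s t, s ≤ t → |G y t - G y s| ≤ F j t - F j s)
    (hH : ∀ (j : ℕ+) (y₁ y₂), ‖y₁‖ ≤ (j : ℝ) → ‖y₂‖ ≤ (j : ℝ) → ∀ s t, s ≤ t →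
      |(G y₁ t - G y₁ s) - (G y₂ t - G y₂ s)| ≤ ω j (nndist y₁ y₂) * (H j t - H j s)) :
    ∃ ν : ParamBMeasure N ω, ∀ y s t, s ≤ t → ν y (Ioc s t) = G y t - G y s := by
  let stieltjesF (j : ℕ+) : StieltjesFunction ℝ := ⟨F j, hFm j, fun _ => (hFc j).continuousWithinAt⟩
  have hG (y : EuclideanSpace ℝ (Fin N)) : Continuous (G y) := by
    obtain ⟨j, hj⟩ := exists_norm_le_pnat y
    exact continuous_of_dominated (hF j y hj) (hFc j)
  have exists_bMeasure (y : EuclideanSpace ℝ (Fin N)) :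
      ∃ μ : BMeasure, ∀ s t, s ≤ t → μ (Ioc s t) = G y t - G y s := by
    obtain ⟨j, hj⟩ := exists_norm_le_pnat y
    exact BMeasure.exists_of_primitive (F := stieltjesF j) (hFc j) (hF j y hj)
  choose ν hν using exists_bMeasure
  refine ⟨⟨ν, fun j => ?_⟩, hν⟩
  have hm : IsMBound ν j (stieltjesF j).measure :=
    isMBound_of_Ioc (hFc j) fun y hy s t hst => hν y s t hst ▸ hF j y hy s t hst
  obtain ⟨l, hl⟩ : ∃ l, IsLBound ω ν j l :=
    exists_isLBound_of_Ioc (hHm j).stieltjesFunction fun y₁ y₂ h₁ h₂ s t hst => by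
      rw [hν y₁ s t hst, hν y₂ s t hst, sub_sub_sub_comm]
      refine abs_sub_le_mul_rightLim ((hG y₁).sub (hG y₂)) (hHm j) (fun u v huv => ?_) hst
      rw [Pi.sub_apply, Pi.sub_apply, sub_sub_sub_comm]
      exact hH j y₁ y₂ h₁ h₂ u v huv
  exact ⟨_, l, hm, hl⟩

end ParamBMeasure

section UltrafilterLimits

variable {ι : Type*}

theorem exists_tendsto_primitive {α : Type*} [LinearOrder α] (V : Ultrafilter ι)
    {f : ι → α → α → ℝ} (hf : ∀ i s t u, s ≤ t → t ≤ u → f i s t + f i t u = f i s u)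
    (hC : ∀ s t, ∃ C, ∀ i, |f i s t| ≤ C) :
    ∃ F : α → ℝ, ∀ s t, s ≤ t → Tendsto (fun i => f i s t) V (𝓝 (F t - F s)) := by
  choose C hC using hC
  choose g hg using fun s t => exists_tendsto_ultrafilter_of_abs_le V (hC s t)
  obtain ⟨F, hF⟩ := exists_primitive_of_additive g fun s t u hst htu =>
    tendsto_nhds_unique ((hg s t).add (hg t u))
      ((hg s u).congr fun i => (hf i s t u hst htu).symm)
  exact ⟨F, fun s t hst => hF s t hst ▸ hg s t⟩

theorem measureReal_Ioc_add (m : Measure ℝ) [IsLocallyFiniteMeasure m] {s t u : ℝ} (h₁ : s ≤ t)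
    (h₂ : t ≤ u) : m.real (Ioc s t) + m.real (Ioc t u) = m.real (Ioc s u) := by
  rw [← Ioc_union_Ioc_eq_Ioc h₁ h₂, measureReal_union_bdd m (isBddBorel_Ioc _ _)
    (isBddBorel_Ioc _ _) (Ioc_disjoint_Ioc_of_le le_rfl)]

theorem exists_measureReal_Ioc_le {μ : ι → Measure ℝ} {d : ℝ} {c : ℝ≥0∞} (hc : c ≠ ∞)
    (hd : 0 < d) (h : ∀ i t, μ i (Icc t (t + d)) ≤ c) (a b : ℝ) :
    ∃ C : ℝ, ∀ i, (μ i).real (Ioc a b) ≤ C := by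
  obtain ⟨n, hn⟩ := exists_nat_ge ((b - a) / d)
  rw [div_le_iff₀ hd] at hn
  have cover (k : ℕ) :
      Ioc a (a + k * d) ⊆ ⋃ r ∈ Finset.range k, Icc (a + r * d) (a + r * d + d) := by
    induction k with
    | zero => simp
    | succ k ih =>
      rw [Finset.range_add_one, Finset.set_biUnion_insert]
      intro x hx
      push_cast at hx
      rcases le_or_gt x (a + k * d) with hxk | hxk
      · exact Or.inr (ih ⟨hx.1, hxk⟩)
      · exact Or.inl ⟨hxk.le, by linarith [hx.2]⟩
  refine ⟨(n * c).toReal, fun i => ENNReal.toReal_mono (by finiteness) ?_⟩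
  calc μ i (Ioc a b) ≤ μ i (⋃ r ∈ Finset.range n, Icc (a + r * d) (a + r * d + d)) :=
        measure_mono ((Ioc_subset_Ioc_right (by linarith)).trans (cover n))
    _ ≤ ∑ r ∈ Finset.range n, μ i (Icc (a + r * d) (a + r * d + d)) :=
        measure_biUnion_finset_le _ _
    _ ≤ n * c := by
        simpa using Finset.sum_le_card_nsmul (Finset.range n) _ c fun r _ => h i (a + r * d)

theorem EquicontinuousMeasures.exists_measureReal_Ioc_le {μ : ι → Measure ℝ}
    (h : EquicontinuousMeasures μ) (a b : ℝ) : ∃ C : ℝ, ∀ i, (μ i).real (Ioc a b) ≤ C := by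
  obtain ⟨δ, hδ, H⟩ := h 1 one_pos
  exact _root_.exists_measureReal_Ioc_le ENNReal.ofReal_ne_top (half_pos hδ)
    (fun i t => (H i t _ (by linarith) (by linarith)).le) a b

theorem BoundedMeasures.exists_measureReal_Ioc_le {μ : ι → Measure ℝ} (h : BoundedMeasures μ)
    (a b : ℝ) : ∃ C : ℝ, ∀ i, (μ i).real (Ioc a b) ≤ C := by
  obtain ⟨c, -, hc⟩ := h
  exact _root_.exists_measureReal_Ioc_le ENNReal.ofReal_ne_top one_pos hc a b

theorem exists_monotone_tendsto_measureReal_Ioc (V : Ultrafilter ι) {μ : ι → Measure ℝ}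
    (hμ : ∀ i, IsLocallyFiniteMeasure (μ i))
    (h : ∀ a b, ∃ C : ℝ, ∀ i, (μ i).real (Ioc a b) ≤ C) :
    ∃ F : ℝ → ℝ, Monotone F ∧
      ∀ s t, s ≤ t → Tendsto (fun i => (μ i).real (Ioc s t)) V (𝓝 (F t - F s)) := by
  obtain ⟨F, hF⟩ := exists_tendsto_primitive V (f := fun i s t => (μ i).real (Ioc s t))
    (fun i s t u => measureReal_Ioc_add (μ i))
    (fun s t => by simpa only [abs_of_nonneg measureReal_nonneg] using h s t)
  exact ⟨F, fun s t hst => sub_nonneg.1 (ge_of_tendsto' (hF s t hst) fun i => measureReal_nonneg),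
    hF⟩

theorem EquicontinuousMeasures.continuous_of_tendsto {V : Filter ι} [NeBot V] {μ : ι → Measure ℝ}
    (h : EquicontinuousMeasures μ) {F : ℝ → ℝ}
    (hF : ∀ s t, s ≤ t → Tendsto (fun i => (μ i).real (Ioc s t)) V (𝓝 (F t - F s))) :
    Continuous F := by
  refine Metric.continuous_iff.2 fun x ε hε => ?_
  obtain ⟨δ, hδ, H⟩ := h (ε / 2) (half_pos hε)
  have dist_le (s t : ℝ) (hst : s ≤ t) (ht : t - s < δ) : dist (F s) (F t) ≤ ε / 2 := by
    rw [dist_comm, Real.dist_eq]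
    refine le_of_tendsto' (hF s t hst).abs fun i => ?_
    rw [abs_of_nonneg measureReal_nonneg]
    exact ENNReal.toReal_le_of_le_ofReal (half_pos hε).le
      ((measure_mono Ioc_subset_Icc_self).trans (H i s t (sub_nonneg.2 hst) ht).le)
  refine ⟨δ, hδ, fun y hy => lt_of_le_of_lt ?_ (half_lt_self hε)⟩
  obtain ⟨hy₁, hy₂⟩ := abs_lt.1 hy
  rcases le_total y x with hyx | hxy
  · exact dist_le y x hyx (by linarith)
  · rw [dist_comm]
    exact dist_le x y hxy hy₂

theorem ParamBMeasure.exists_tendsto_Ioc {N : ℕ} {ω : ModulusFamily} (V : Ultrafilter ι)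
    {ν : ι → ParamBMeasure N ω} {m l : ι → ℕ+ → Measure ℝ}
    (hm : ∀ i j, IsMBound (ν i) j (m i j)) (hme : ∀ j, EquicontinuousMeasures fun i => m i j)
    (hl : ∀ i j, IsLBound ω (ν i) j (l i j)) (hlb : ∀ j, BoundedMeasures fun i => l i j) :
    ∃ μ : ParamBMeasure N ω, ∀ y s t,
      Tendsto (fun i => ν i y (Ioc s t)) V (𝓝 (μ y (Ioc s t))) := by
  choose F hFmono hF using fun j => exists_monotone_tendsto_measureReal_Ioc V
    (fun i => (hm i j).1.1) (hme j).exists_measureReal_Ioc_le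
  choose H hHmono hH using fun j => exists_monotone_tendsto_measureReal_Ioc V
    (fun i => (hl i j).1.1) (hlb j).exists_measureReal_Ioc_le
  have exists_primitive (y : EuclideanSpace ℝ (Fin N)) : ∃ G : ℝ → ℝ, ∀ s t, s ≤ t →
      Tendsto (fun i => ν i y (Ioc s t)) V (𝓝 (G t - G s)) := by
    obtain ⟨j, hj⟩ := exists_norm_le_pnat y
    refine exists_tendsto_primitive V (fun i s t u => (ν i y).Ioc_add) fun s t => ?_
    obtain ⟨C, hC⟩ := (hme j).exists_measureReal_Ioc_le s t
    exact ⟨C, fun i => (abs_apply_le (hm i j) (isBddBorel_Ioc s t) hj).trans (hC i)⟩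
  choose G hG using exists_primitive
  obtain ⟨μ, hμ⟩ := ParamBMeasure.exists_of_primitives (ω := ω)
    (fun j => (hme j).continuous_of_tendsto (hF j)) hFmono hHmono
    (fun j y hy s t hst => le_of_tendsto_of_tendsto' (hG y s t hst).abs (hF j s t hst) fun i =>
      abs_apply_le (hm i j) (isBddBorel_Ioc s t) hy)
    (fun j y₁ y₂ h₁ h₂ s t hst => le_of_tendsto_of_tendsto'
      ((hG y₁ s t hst).sub (hG y₂ s t hst)).abs ((hH j s t hst).const_mul _) fun i =>
        (abs_sub_apply_le (hl i j) (isBddBorel_Ioc s t) h₁ h₂).trans_eq (mul_comm _ _))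
  refine ⟨μ, fun y s t => ?_⟩
  rcases le_total s t with hst | hts
  · exact hμ y s t hst ▸ hG y s t hst
  · simp only [Ioc_eq_empty_of_le hts, BMeasure.empty_apply, tendsto_const_nhds]

end UltrafilterLimits

section Convergence

variable {N : ℕ} {ω : ModulusFamily}

/-- A seminorm on parametric b-measures is *interval-controlled* if, up to an arbitrarily small
multiple of the mass that an `l`-bound on a fixed ball gives to a fixed interval, it is dominated
by finitely many interval values `|ν_y((s, t])|`. This is the common property of the seminorms
defining `σ_D` and `σ_Θ` on which compactness rests. -/
def IsIntervalControlled (p : Seminorm ℝ (ParamBMeasure N ω)) : Prop :=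
  ∃ (j : ℕ+) (a b : ℝ), ∀ ε : ℝ, 0 < ε →
    ∃ (Y : Finset (EuclideanSpace ℝ (Fin N))) (n : ℕ) (t : ℕ → ℝ),
      ∀ (ν : ParamBMeasure N ω) (l : Measure ℝ), IsLBound ω ν j l →
        p ν ≤ ∑ y ∈ Y, ∑ k ∈ Finset.range n, |ν y (Ioc (t k) (t (k + 1)))| + ε * l.real (Ioc a b)

theorem isIntervalControlled_seminormD (y : EuclideanSpace ℝ (Fin N)) (I : RatInterval) :
    IsIntervalControlled (seminormD (ω := ω) y I) := by
  refine ⟨1, 0, 0, fun ε _ => ⟨{y}, 1, fun k => if k = 0 then I.left else I.right,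
    fun ν l _ => ?_⟩⟩
  change |ν y (Icc (I.left : ℝ) I.right)| ≤ _
  simp [BMeasure.Icc_eq_Ioc _ I.lt_real.le]

theorem exists_forall_coe_lt_of_continuous {f : ℝ≥0 → ℝ≥0} (hf : Continuous f) (h0 : f 0 = 0)
    {η : ℝ} (hη : 0 < η) : ∃ δ > 0, ∀ r : ℝ≥0, (r : ℝ) < δ → (f r : ℝ) < η := by
  simpa [NNReal.dist_eq, h0] using Metric.continuous_iff.1 hf 0 η hη

theorem SuitableModuli.exists_forall_curves_modulus_le (Θ : SuitableModuli) (I : RatInterval)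
    (j : ℕ+) {η : ℝ} (hη : 0 < η) :
    ∃ δ > 0, ∀ y ∈ Θ.curves N I j, ∀ s ∈ I.set, ∀ s' ∈ I.set, |s - s'| < δ →
      (ω j (nndist (y s) (y s')) : ℝ) ≤ η := by
  obtain ⟨δ, hδ, H⟩ := exists_forall_coe_lt_of_continuous
    ((ω.continuous j).comp (Θ.continuous I j)) (by simp [Θ.zero, ω.zero]) hη
  exact ⟨δ, hδ, fun y hy s hs s' hs' hss => (NNReal.coe_le_coe.2
    (ω.monotone j (hy.2.2 s hs s' hs'))).trans (H (nndist s s') hss).le⟩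

section RiemannSums

variable (ν : ParamBMeasure N ω) {j : ℕ+} {l : Measure ℝ} (hl : IsLBound ω ν j l)
  {y : ℝ → EuclideanSpace ℝ (Fin N)} {a b δ η : ℝ} (hy : ∀ s ∈ Icc a b, ‖y s‖ ≤ (j : ℝ))
  {n : ℕ} {t τ : ℕ → ℝ} (hP : IsTaggedPartition δ a b n t τ)

include hl hy hP

theorem abs_paramIntegral_sub_riemannSum_le (hab : a < b) (hδ : 0 < δ)
    (hc : ContinuousOn y (Icc a b))
    (hη : ∀ s ∈ Icc a b, ∀ s' ∈ Icc a b, |s - s'| < 2 * δ →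
      (ω j (nndist (y s) (y s')) : ℝ) ≤ η) :
    |paramIntegral ν y a b - riemannSum ν y n t τ| ≤ η * l.real (Ioc a b) := by
  refine le_of_forall_pos_le_add fun ε hε => ?_
  obtain ⟨δ', hδ', hlim⟩ := hasParamIntegral_paramIntegral ν hab hc ε hε
  obtain ⟨n', t', τ', hP'⟩ := exists_taggedPartition hab (lt_min hδ hδ')
  have hfine := hlim n' t' τ' (hP'.mono (min_le_right _ _))
  have hosc := abs_riemannSum_sub_le ν hl hy hη (hP'.mono (min_le_left _ _)) hP
  have := abs_sub_le (paramIntegral ν y a b) (riemannSum ν y n' t' τ') (riemannSum ν y n t τ)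
  linarith

theorem abs_riemannSum_sub_sum_le {z : ℕ → EuclideanSpace ℝ (Fin N)}
    (hz : ∀ k < n, ‖z k‖ ≤ (j : ℝ)) (hη : ∀ k < n, (ω j (nndist (y (τ k)) (z k)) : ℝ) ≤ η) :
    |riemannSum ν y n t τ - ∑ k ∈ Finset.range n, ν (z k) (Ioc (t k) (t (k + 1)))| ≤
      η * l.real (Ioc a b) := by
  have := hl.1.1
  have hsplit := (sum_inter_Ioc (fun A B => measureReal_union_bdd l) (isBddBorel_Ioc a b) t n
    fun k hk => (hP.2.2 k hk).1).2
  rw [hP.1, hP.2.1, inter_self] at hsplit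
  rw [hsplit, riemannSum, ← Finset.sum_sub_distrib, Finset.mul_sum]
  refine Finset.abs_sum_le_sum_abs _ _ |>.trans <| Finset.sum_le_sum fun k hk => ?_
  rw [Finset.mem_range] at hk
  obtain ⟨hlt, hτ, -⟩ := hP.2.2 k hk
  have hsub := hP.Icc_subset hk
  rw [inter_eq_right.2 (Ioc_subset_Ioc (hsub (left_mem_Icc.2 hlt.le)).1
    (hsub (right_mem_Icc.2 hlt.le)).2), BMeasure.Icc_eq_Ioc _ hlt.le, mul_comm]
  exact (abs_sub_apply_le hl (isBddBorel_Ioc _ _) (hy _ (hsub hτ)) (hz k hk)).trans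
    (mul_le_mul_of_nonneg_left (hη k hk) measureReal_nonneg)

end RiemannSums

theorem isIntervalControlled_seminormTheta (Θ : SuitableModuli) (I : RatInterval) (j : ℕ+) :
    IsIntervalControlled (seminormTheta (N := N) (ω := ω) Θ I j) := by
  refine ⟨j, I.left, I.right, fun ε hε => ?_⟩
  obtain ⟨δ, hδ, hosc⟩ := Θ.exists_forall_curves_modulus_le (N := N) (ω := ω) I j (half_pos hε)
  obtain ⟨ρ, hρ, hωρ⟩ :=
    exists_forall_coe_lt_of_continuous (ω.continuous j) (ω.zero j) (half_pos hε)
  obtain ⟨n, t, τ, hP⟩ := exists_taggedPartition I.lt_real (half_pos hδ)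
  obtain ⟨Y, hY, hYfin, hYcover⟩ := (isCompact_closedBall
    (0 : EuclideanSpace ℝ (Fin N)) (j : ℝ)).finite_cover_balls hρ
  refine ⟨hYfin.toFinset, n, t, fun ν l hl => Real.iSup_le (fun ⟨y, hy⟩ => ?_) (by positivity)⟩
  have exists_near (k : ℕ) (hk : k < n) : ∃ z ∈ Y, (nndist (y (τ k)) z : ℝ) < ρ := by
    have hmem : y (τ k) ∈ Metric.closedBall (0 : EuclideanSpace ℝ (Fin N)) (j : ℝ) :=
      mem_closedBall_zero_iff.2 (hy.2.1 _ (hP.Icc_subset hk (hP.2.2 k hk).2.1))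
    simpa using hYcover hmem
  choose! z hzY hzρ using exists_near
  have hint := abs_paramIntegral_sub_riemannSum_le ν hl hy.2.1 hP I.lt_real (half_pos hδ) hy.1
    fun s hs s' hs' hss => hosc y hy s hs s' hs' (by linarith)
  have hsum := abs_riemannSum_sub_sum_le ν hl hy.2.1 hP
    (fun k hk => mem_closedBall_zero_iff.1 (hY (hzY k hk))) fun k hk => (hωρ _ (hzρ k hk)).le
  have hnet : |∑ k ∈ Finset.range n, ν (z k) (Ioc (t k) (t (k + 1)))| ≤
      ∑ y ∈ hYfin.toFinset, ∑ k ∈ Finset.range n, |ν y (Ioc (t k) (t (k + 1)))| := by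
    rw [Finset.sum_comm]
    refine Finset.abs_sum_le_sum_abs _ _ |>.trans <| Finset.sum_le_sum fun k hk => ?_
    exact Finset.single_le_sum (f := fun x => |ν x (Ioc (t k) (t (k + 1)))|)
      (fun _ _ => abs_nonneg _) (hYfin.mem_toFinset.2 (hzY k (Finset.mem_range.1 hk)))
  rw [abs_le] at hint hsum hnet ⊢
  constructor <;> linarith

theorem ParamBMeasure.sub_apply (ν₁ ν₂ : ParamBMeasure N ω) (y : EuclideanSpace ℝ (Fin N))
    (A : Set ℝ) : (ν₁ - ν₂) y A = ν₁ y A - ν₂ y A := rfl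

theorem IsLBound.sub {ν₁ ν₂ : ParamBMeasure N ω} {j : ℕ+} {l₁ l₂ : Measure ℝ}
    (h₁ : IsLBound ω ν₁ j l₁) (h₂ : IsLBound ω ν₂ j l₂) :
    IsLBound ω (ν₁ - ν₂ : ParamBMeasure N ω) j (l₁ + l₂) := by
  refine isLBound_of_abs_sub_le (h₁.1.add h₂.1) fun A hA y₁ y₂ hy₁ hy₂ => ?_
  have := h₁.1.1
  have := h₂.1.1
  rw [measureReal_add_apply (hA.measure_ne_top l₁) (hA.measure_ne_top l₂), add_mul,
    ParamBMeasure.sub_apply, ParamBMeasure.sub_apply, sub_sub_sub_comm]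
  exact (abs_sub _ _).trans
    (add_le_add (abs_sub_apply_le h₁ hA hy₁ hy₂) (abs_sub_apply_le h₂ hA hy₁ hy₂))

variable {ι κ : Type*} {ν : ι → ParamBMeasure N ω}

theorem IsIntervalControlled.tendsto_zero {p : Seminorm ℝ (ParamBMeasure N ω)}
    (hp : IsIntervalControlled p) {f : Filter ι} {l : ι → ℕ+ → Measure ℝ}
    (hl : ∀ i j, IsLBound ω (ν i) j (l i j))
    (hlb : ∀ j a b, ∃ C : ℝ, ∀ i, (l i j).real (Ioc a b) ≤ C)
    (hν : ∀ y s t, Tendsto (fun i => ν i y (Ioc s t)) f (𝓝 0)) :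
    Tendsto (fun i => p (ν i)) f (𝓝 0) := by
  obtain ⟨j, a, b, hp⟩ := hp
  obtain ⟨C, hC⟩ := hlb j a b
  refine tendsto_order.2 ⟨fun r hr => Eventually.of_forall fun i => hr.trans_le (apply_nonneg p _),
    fun r hr => ?_⟩
  obtain ⟨ε, hε, hCε⟩ := exists_pos_mul_lt (half_pos hr) C
  obtain ⟨Y, n, t, hpν⟩ := hp ε hε
  have hsum : Tendsto (fun i => ∑ y ∈ Y, ∑ k ∈ Finset.range n, |ν i y (Ioc (t k) (t (k + 1)))|)
      f (𝓝 0) := by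
    simpa using tendsto_finsetSum Y fun y _ => tendsto_finsetSum (Finset.range n) fun k _ =>
      (hν y (t k) (t (k + 1))).abs
  filter_upwards [hsum.eventually_lt_const (half_pos hr)] with i hi
  have hεC := mul_le_mul_of_nonneg_left (hC i) hε.le
  linarith [hpν (ν i) (l i j) (hl i j)]

theorem tendsto_seminormTopology_of_Ioc {p : κ → Seminorm ℝ (ParamBMeasure N ω)}
    (hp : ∀ k, IsIntervalControlled (p k)) {f : Filter ι} {μ : ParamBMeasure N ω}
    {l : ι → ℕ+ → Measure ℝ} (hl : ∀ i j, IsLBound ω (ν i) j (l i j))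
    (hlb : ∀ j a b, ∃ C : ℝ, ∀ i, (l i j).real (Ioc a b) ≤ C)
    (hν : ∀ y s t, Tendsto (fun i => ν i y (Ioc s t)) f (𝓝 (μ y (Ioc s t)))) :
    Tendsto ν f (@nhds _ (seminormTopology p) μ) := by
  choose _ l₀ _ hl₀ using μ.2
  refine (tendsto_seminormTopology p).2 fun k => (hp k).tendsto_zero
    (fun i j => (hl i j).sub (hl₀ j)) (fun j a b => ?_) fun y s t => ?_
  · obtain ⟨C, hC⟩ := hlb j a b
    refine ⟨C + (l₀ j).real (Ioc a b), fun i => ?_⟩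
    have := (hl i j).1.1
    have := (hl₀ j).1.1
    rw [measureReal_add_apply measure_Ioc_lt_top.ne measure_Ioc_lt_top.ne]
    exact add_le_add_left (hC i) _
  · simpa only [ParamBMeasure.sub_apply, sub_self] using (hν y s t).sub_const (μ y (Ioc s t))

theorem isCompact_closure_range_of_bounds {p : κ → Seminorm ℝ (ParamBMeasure N ω)}
    (hp : ∀ k, IsIntervalControlled (p k)) {m l : ι → ℕ+ → Measure ℝ}
    (hm : ∀ i j, IsMBound (ν i) j (m i j)) (hme : ∀ j, EquicontinuousMeasures fun i => m i j)
    (hl : ∀ i j, IsLBound ω (ν i) j (l i j)) (hlb : ∀ j, BoundedMeasures fun i => l i j) :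
    @IsCompact _ (seminormTopology p) (closure[seminormTopology p] (range ν)) := by
  let _ := seminormTopology p
  have := regularSpace_seminormTopology p
  refine isCompact_closure_range_of_ultrafilter fun V => ?_
  obtain ⟨μ, hμ⟩ := ParamBMeasure.exists_tendsto_Ioc V hm hme hl hlb
  exact ⟨μ, tendsto_seminormTopology_of_Ioc hp hl (fun j => (hlb j).exists_measureReal_Ioc_le) hμ⟩

end Convergence

section Caratheodory

theorem IsBddBorel.integrableOn {E : Type*} [NormedAddCommGroup E] {f : ℝ → E} {m : Measure ℝ}
    (hf : LocallyIntegrable f m) {A : Set ℝ} (hA : IsBddBorel A) : IntegrableOn f A m :=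
  (hf.integrableOn_isCompact hA.2.isCompact_closure).mono_set subset_closure

/-- The measure `f(t) dt`, for densities `f ≥ 0`; the negative part of `f` is discarded. -/
def densityMeasure (f : ℝ → ℝ) : Measure ℝ := volume.withDensity fun t => ENNReal.ofReal (f t)

section DensityMeasure

variable {f : ℝ → ℝ} (hf : LocallyIntegrable f volume) (h0 : ∀ t, 0 ≤ f t)

include hf h0

theorem densityMeasure_apply {A : Set ℝ} (hA : IsBddBorel A) :
    densityMeasure f A = ENNReal.ofReal (∫ t in A, f t) := by
  rw [densityMeasure, withDensity_apply _ hA.1,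
    ofReal_integral_eq_lintegral_ofReal (hA.integrableOn hf) (Eventually.of_forall h0)]

theorem densityMeasure_real_apply {A : Set ℝ} (hA : IsBddBorel A) :
    (densityMeasure f).real A = ∫ t in A, f t := by
  rw [measureReal_def, densityMeasure_apply hf h0 hA,
    ENNReal.toReal_ofReal (integral_nonneg h0)]

theorem densityMeasure_Icc {s t : ℝ} (hst : s ≤ t) :
    densityMeasure f (Icc s t) = ENNReal.ofReal (∫ x in s..t, f x) := by
  rw [densityMeasure_apply hf h0 (isBddBorel_Icc _ _), integral_Icc_eq_integral_Ioc,
    intervalIntegral.integral_of_le hst]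

theorem isContinuousMeasure_densityMeasure : IsContinuousMeasure (densityMeasure f) := by
  refine ⟨⟨fun x => ⟨Icc (x - 1) (x + 1), Icc_mem_nhds (by linarith) (by linarith), ?_⟩⟩,
    fun t => withDensity_absolutelyContinuous _ _ (measure_singleton t)⟩
  rw [densityMeasure_apply hf h0 (isBddBorel_Icc _ _)]
  exact ENNReal.ofReal_lt_top

end DensityMeasure

section DensityFamilies

variable {Γ : Type*} {f : Γ → ℝ → ℝ} (hf : ∀ α, LocallyIntegrable (f α) volume)
  (h0 : ∀ α t, 0 ≤ f α t)

include hf h0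

theorem equicontinuousMeasures_densityMeasure
    (h : ∀ ε : ℝ, 0 < ε → ∃ δ : ℝ, 0 < δ ∧ ∀ α s h, 0 ≤ h → h < δ →
      ∫ t in s..(s + h), f α t < ε) :
    EquicontinuousMeasures fun α => densityMeasure (f α) := by
  intro ε hε
  obtain ⟨δ, hδ, H⟩ := h ε hε
  refine ⟨δ, hδ, fun α s t hst htδ => ?_⟩
  rw [densityMeasure_Icc (hf α) (h0 α) (sub_nonneg.1 hst), ENNReal.ofReal_lt_ofReal_iff hε]
  simpa only [add_sub_cancel] using H α s (t - s) hst htδ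

theorem boundedMeasures_densityMeasure
    (h : ∃ c : ℝ, 0 < c ∧ ∀ α s, ∫ t in s..(s + 1), f α t ≤ c) :
    BoundedMeasures fun α => densityMeasure (f α) := by
  obtain ⟨c, hc, H⟩ := h
  refine ⟨c, hc, fun α t => ?_⟩
  rw [densityMeasure_Icc (hf α) (h0 α) (by linarith)]
  exact ENNReal.ofReal_le_ofReal (H α t)

end DensityFamilies

namespace IsCaratheodory

variable {N : ℕ} {ω : ModulusFamily}
  {g : EuclideanSpace ℝ (Fin N) → ℝ → EuclideanSpace ℝ (Fin N)} {m l : ℕ+ → ℝ → ℝ}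
  (hg : IsCaratheodory ω g m l) (i : Fin N)

include hg in
theorem integrableOn (y : EuclideanSpace ℝ (Fin N)) {A : Set ℝ} (hA : IsBddBorel A) :
    IntegrableOn (fun t => g y t i) A volume := by
  obtain ⟨j, hy⟩ := exists_norm_le_pnat y
  have hmeas : AEStronglyMeasurable (fun t => g y t i) volume :=
    ((EuclideanSpace.proj (𝕜 := ℝ) i).continuous.measurable.comp_aemeasurable
      (hg.measurable y)).aestronglyMeasurable
  refine (hA.integrableOn (hg.m_locallyIntegrable j)).mono' hmeas.restrict
    (ae_restrict_of_ae ?_)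
  filter_upwards [hg.m_bound j] with t ht
  exact (PiLp.norm_apply_le (g y t) i).trans (ht y hy)

/-- The `i`-th component of a Carathéodory vector field at the point `y`, as the b-measure
`A ↦ ∫_A g_i(y, t) dt`. -/
def bMeasure (y : EuclideanSpace ℝ (Fin N)) : BMeasure :=
  BMeasure.mk (fun A => ∫ t in A, g y t i) (by simp)
    (fun _ hA hd hU => hasSum_integral_iUnion (fun n => (hA n).1) hd (hg.integrableOn i y hU))
    (fun t => by simp [Measure.restrict_singleton])

theorem bMeasure_apply (y : EuclideanSpace ℝ (Fin N)) {A : Set ℝ} (hA : IsBddBorel A) :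
    hg.bMeasure i y A = ∫ t in A, g y t i :=
  BMeasure.mk_apply hA

theorem isMBound (j : ℕ+) : IsMBound (hg.bMeasure i) j (densityMeasure (m j)) := by
  have hm := hg.m_locallyIntegrable j
  refine isMBound_of_abs_le (isContinuousMeasure_densityMeasure hm (hg.m_nonneg j))
    fun A hA y hy => ?_
  rw [hg.bMeasure_apply i y hA, densityMeasure_real_apply hm (hg.m_nonneg j) hA,
    ← Real.norm_eq_abs]
  refine norm_integral_le_of_norm_le (hA.integrableOn hm) (ae_restrict_of_ae ?_)
  filter_upwards [hg.m_bound j] with t ht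
  exact (PiLp.norm_apply_le (g y t) i).trans (ht y hy)

theorem isLBound (j : ℕ+) : IsLBound ω (hg.bMeasure i) j (densityMeasure (l j)) := by
  have hl := hg.l_locallyIntegrable j
  refine isLBound_of_abs_sub_le (isContinuousMeasure_densityMeasure hl (hg.l_nonneg j))
    fun A hA y₁ y₂ h₁ h₂ => ?_
  rw [hg.bMeasure_apply i _ hA, hg.bMeasure_apply i _ hA,
    ← integral_sub (hg.integrableOn i y₁ hA) (hg.integrableOn i y₂ hA),
    densityMeasure_real_apply hl (hg.l_nonneg j) hA, ← integral_mul_const, ← Real.norm_eq_abs]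
  refine norm_integral_le_of_norm_le ((hA.integrableOn hl).mul_const _) (ae_restrict_of_ae ?_)
  filter_upwards [hg.l_bound j] with t ht
  exact (PiLp.norm_apply_le (g y₁ t - g y₂ t) i).trans (ht y₁ y₂ h₁ h₂)

/-- The `i`-th component of a Carathéodory vector field as a parametric b-measure. -/
def paramBMeasure : ParamBMeasure N ω :=
  ⟨hg.bMeasure i, fun j => ⟨_, _, hg.isMBound i j, hg.isLBound i j⟩⟩

end IsCaratheodory

end Caratheodory

theorem isCompact_closure_range_pi {ι κ : Type*} {X : κ → Type*} [∀ k, TopologicalSpace (X k)]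
    {f : ι → ∀ k, X k} (h : ∀ k, IsCompact (closure (range fun i => f i k))) :
    IsCompact (closure (range f)) :=
  (isCompact_univ_pi h).of_isClosed_subset isClosed_closure <|
    closure_minimal (range_subset_iff.2 fun i _ _ => subset_closure (mem_range_self i)) <|
      isClosed_set_pi fun _ _ => isClosed_closure

theorem IsSigmaTopology.exists_eq_seminormTopology {N : ℕ} {ω : ModulusFamily}
    {T : TopologicalSpace (ParamBMeasure N ω)} (hT : IsSigmaTopology T) :
    ∃ (κ : Type) (p : κ → Seminorm ℝ (ParamBMeasure N ω)),
      (∀ k, IsIntervalControlled (p k)) ∧ T = seminormTopology p := by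
  rcases hT with ⟨D, -, -, rfl⟩ | ⟨Θ, rfl⟩
  · exact ⟨D × RatInterval, fun q => seminormD q.1.1 q.2,
      fun q => isIntervalControlled_seminormD q.1.1 q.2, rfl⟩
  · exact ⟨RatInterval × ℕ+, fun q => seminormTheta Θ q.1 q.2,
      fun q => isIntervalControlled_seminormTheta Θ q.1 q.2, rfl⟩

theorem mainTheorem1_general {N : ℕ} {ω : ModulusFamily} {κ : Type*}
    {p : κ → Seminorm ℝ (ParamBMeasure N ω)} (hp : ∀ k, IsIntervalControlled (p k)) :
    (∀ E : Set (ParamBMeasure N ω), HasEquicontinuousMBounds E → HasBoundedLBounds E →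
      @IsCompact (ParamBMeasure N ω) (seminormTopology p) (closure[seminormTopology p] E)) ∧
    (∀ (Γ : Type*) (g : Γ → EuclideanSpace ℝ (Fin N) → ℝ → EuclideanSpace ℝ (Fin N)),
      IsBoundedCaratheodoryFamily ω g →
      ∃ ν : Γ → Fin N → ParamBMeasure N ω,
        (∀ α i y A, IsBddBorel A → ν α i y A = ∫ t in A, g α y t i) ∧
        @IsCompact (Fin N → ParamBMeasure N ω)
          (@Pi.topologicalSpace _ _ fun _ => seminormTopology p)
          (@closure _ (@Pi.topologicalSpace _ _ fun _ => seminormTopology p) (range ν))) := by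
  constructor
  · rintro E ⟨m, hm, hme⟩ ⟨l, hl, hlb⟩
    simpa only [Subtype.range_coe] using isCompact_closure_range_of_bounds hp hm hme hl hlb
  · rintro Γ g ⟨m, l, hg, hm, hl⟩
    refine ⟨fun α i => (hg α).paramBMeasure i, fun α i y A => (hg α).bMeasure_apply i y, ?_⟩
    let _ := seminormTopology p
    exact isCompact_closure_range_pi fun i => isCompact_closure_range_of_bounds hp
      (fun α j => (hg α).isMBound i j)
      (fun j => equicontinuousMeasures_densityMeasure (fun α => (hg α).m_locallyIntegrable j)
        (fun α => (hg α).m_nonneg j) (hm j))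
      (fun α j => (hg α).isLBound i j)
      (fun j => boundedMeasures_densityMeasure (fun α => (hg α).l_locallyIntegrable j)
        (fun α => (hg α).l_nonneg j) (hl j))

end

theorem mainTheorem1 (N : ℕ) (ω : ModulusFamily) (T : TopologicalSpace (ParamBMeasure N ω))
    (hT : IsSigmaTopology T) :
    (∀ E : Set (ParamBMeasure N ω), HasEquicontinuousMBounds E → HasBoundedLBounds E →
      @IsCompact (ParamBMeasure N ω) T (closure[T] E)) ∧
    (∀ (Γ : Type*) (g : Γ → EuclideanSpace ℝ (Fin N) → ℝ → EuclideanSpace ℝ (Fin N)),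
      IsBoundedCaratheodoryFamily ω g →
      ∃ ν : Γ → Fin N → ParamBMeasure N ω,
        (∀ α i y A, IsBddBorel A → ν α i y A = ∫ t in A, g α y t i) ∧
        @IsCompact (Fin N → ParamBMeasure N ω) (@Pi.topologicalSpace _ _ fun _ => T)
          (@closure _ (@Pi.topologicalSpace _ _ fun _ => T) (range ν))) := by
  obtain ⟨κ, p, hp, rfl⟩ := hT.exists_eq_seminormTopology
  exact mainTheorem1_general hp
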